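/- Let $a,b\ge 2$ and $P=\mathbb Z[x_0,\dots,x_a,y_0,\dots,y_b]$ with the degree reverse lexicographic order for $x_0>\cdots>x_a>y_0>\cdots>y_b$. Let $\mathcal G\subset P$ consist of the $2\times 2$ minors of $$\begin{pmatrix}x_0&x_1&\dots&x_{a-1}\\ x_1&x_2&\dots&x_a\end{pmatrix},\qquad \begin{pmatrix}y_0&y_1&\dots&y_{b-1}\\ y_1&y_2&\dots&y_b\end{pmatrix}$$ and of the forms $x_{i+2}y_j-2x_{i+1}y_{j+1}+x_iy_{j+2}$ for $0\le i\le a-2$, $0\le j\le b-2$. The carpet $X^{\mathbb Z}(a,b)\subset\mathbb P^{a+b+1}_{\mathbb Z}$ is the subscheme defined by $\mathcal G$; let $I$ be its saturated ideal (the saturation of $(\mathcal G)$ with respect to $(x_0,\dots,x_a,y_0,\dots,y_b)$), and let $\mathrm{in}(I)$ be the ideal generated by the leading terms of all elements of $I$. Then $I=(\mathcal G)$, and $\mathcal G$ is a normalized Gröbner basis of $I$: the leading coefficients are $\pm1$, no leading monomial of an element of $\mathcal G$ divides that of another one, and the leading terms of $\mathcal G$ generate $\mathrm{in}(I)$. The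 Schreyer resolution $F$ of $\mathrm{in}(I)$ built from $\mathcal G$ is the following complex of free $P$-modules with chosen bases. Monomials are listed by increasing degree and, within one degree, decreasingly in the monomial order. $F_0=P$ has one basis element, with the empty name. The basis element of $F_1$ named $(m)$, for $m$ a leading monomial of an element of $\mathcal G$, is mapped to $m$. If $w=(m_1,\dots,m_p)$, $p\ge1$, is the name of a basis element $e_w$ of $F_p$, then $(m_1,\dots,m_p,m)$ is the name of a basis element of $F_{p+1}$ if and only if $m$ is a minimal monomial generator of $$M_w=\bigl(t : (m_1,\dots,m_{p-1},t)\text{ is a name and } t\text{ is listed before } m_p\bigr):m_p .$$ This basis element is mapped to the syzygy $m\,e_w-\sum_v g_v e_v$ obtained from the division with remainder of $m\,d(e_w)$ by the elements $d(e_v)$: it lies in the kernel of $d\colon F_p\to F_{p-1}$, its leading term for the induced monomial order is $m\,e_w$, and no term of $g_v$ lies in $M_v$. (In the induced order terms $\gamma e_v$ are compared by the leading terms of $\gamma\,d(e_v)$, and in case of equality the term whose basis element is listed later is the larger one.) The Schreyer resolution of $\mathrm{in}(I)$ exists, and it is a minimal graded free resolution of $P/\mathrm{in}(I)$ by free modules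 of finite rank, where a basis element has as its degree the degree of the product of the monomials in its name; minimal means that no matrix entry of a differential has a nonzero constant term. -/

import Mathlib

open MvPolynomial

noncomputable section

namespace Carpet

section MonomialOrders

set_option linter.unusedSectionVars false

variable (σ : Type) [LinearOrder σ] [Fintype σ]

/-- A copy of the monoid of exponent vectors, to carry the degree reverse lexicographic order. -/
@[ext]
structure DegRevLex where
  exps : σ →₀ ℕ

/-- Each exponent vector is a copy of itself. -/
def degRevLexEquiv : (σ →₀ ℕ) ≃ DegRevLex σ where
  toFun := DegRevLex.mk
  invFun := DegRevLex.exps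
  left_inv _ := rfl
  right_inv _ := rfl

instance : AddCommMonoid (DegRevLex σ) := (degRevLexEquiv σ).symm.addCommMonoid

/-- Compare the total degrees first; then compare the exponents, the last variable first, where a
larger exponent makes the monomial smaller. -/
def degRevLexKey (α : σ →₀ ℕ) : ℕ ×ₗ Lex (σᵒᵈ → ℕᵒᵈ) :=
  toLex (α.degree, toLex fun i => OrderDual.toDual (α (OrderDual.ofDual i)))

theorem degRevLexKey_injective : Function.Injective (degRevLexKey σ) := by
  intro α β h
  have h2 := congrArg (fun z => ofLex (ofLex z).2) h
  ext i
  exact OrderDual.toDual.injective (congrFun h2 (OrderDual.toDual i))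

theorem degRevLexKey_lt_iff (α β : σ →₀ ℕ) :
    degRevLexKey σ α < degRevLexKey σ β ↔
      α.degree < β.degree ∨
        (α.degree = β.degree ∧ ∃ i, (∀ j, i < j → α j = β j) ∧ β i < α i) := by
  rw [degRevLexKey, degRevLexKey, Prod.Lex.toLex_lt_toLex]
  refine or_congr Iff.rfl (and_congr Iff.rfl ?_)
  constructor
  · rintro ⟨i, h1, h2⟩
    exact ⟨OrderDual.ofDual i,
      fun j hj => OrderDual.toDual.injective (h1 (OrderDual.toDual j) hj), h2⟩
  · rintro ⟨i, h1, h2⟩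
    exact ⟨OrderDual.toDual i,
      fun j hj => congrArg OrderDual.toDual (h1 (OrderDual.ofDual j) hj), h2⟩

instance : LinearOrder (DegRevLex σ) :=
  LinearOrder.lift' (fun α => degRevLexKey σ α.exps)
    ((degRevLexKey_injective σ).comp (degRevLexEquiv σ).symm.injective)

theorem degRevLex_lt_iff (α β : DegRevLex σ) :
    α < β ↔ α.exps.degree < β.exps.degree ∨
        (α.exps.degree = β.exps.degree ∧
          ∃ i, (∀ j, i < j → α.exps j = β.exps j) ∧ β.exps i < α.exps i) :=
  degRevLexKey_lt_iff σ α.exps β.exps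

theorem degRevLex_add_exps (α β : DegRevLex σ) : (α + β).exps = α.exps + β.exps := rfl

theorem degRevLex_add_lt (α β γ : DegRevLex σ) (h : α < β) : α + γ < β + γ := by
  rw [degRevLex_lt_iff] at h ⊢
  simpa [degRevLex_add_exps, map_add] using h

instance : IsOrderedAddMonoid (DegRevLex σ) where
  add_le_add_left α β h γ := by
    rcases h.lt_or_eq with h | h
    · exact (degRevLex_add_lt σ α β γ h).le
    · rw [h]

theorem degRevLex_monotone {α β : σ →₀ ℕ} (h : α ≤ β) :
    DegRevLex.mk α ≤ DegRevLex.mk β := by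
  obtain ⟨γ, rfl⟩ := exists_add_of_le h
  rcases eq_or_ne γ 0 with rfl | hγ
  · rw [add_zero]
  · refine le_of_lt ((degRevLex_lt_iff σ _ _).2 (Or.inl ?_))
    have : Finsupp.degree γ ≠ 0 := by
      rwa [Ne, Finsupp.degree_eq_zero_iff]
    simp only [map_add]
    omega

instance : WellFoundedLT (DegRevLex σ) := by
  refine ⟨RelEmbedding.wellFounded_iff_isEmpty.2 ⟨fun f => ?_⟩⟩
  obtain ⟨m, n, hmn, hle⟩ := wellQuasiOrdered_le (α := σ →₀ ℕ) (fun k => (f k).exps)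
  exact absurd (f.map_rel_iff.2 hmn) (not_lt.2 (degRevLex_monotone σ hle))

/-- The (degree) reverse lexicographic order on the monomials in the variables `σ`, where a smaller
index means a larger variable. -/
def degRevLex : MonomialOrder σ where
  syn := DegRevLex σ
  toSyn := { degRevLexEquiv σ with map_add' := fun _ _ => rfl }
  toSyn_monotone _ _ h := degRevLex_monotone σ h

theorem degRevLex_toSyn_lt_iff (α β : σ →₀ ℕ) :
    (degRevLex σ).toSyn α < (degRevLex σ).toSyn β ↔
      α.degree < β.degree ∨
        (α.degree = β.degree ∧ ∃ i, (∀ j, i < j → α j = β j) ∧ β i < α i) :=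
  degRevLexKey_lt_iff σ α β

end MonomialOrders

section Ideals

variable {σ : Type} {R : Type} [CommRing R]

/-- The initial ideal: generated by the leading terms of all elements of `I`. -/
def initialIdeal (ord : MonomialOrder σ) (I : Ideal (MvPolynomial σ R)) :
    Ideal (MvPolynomial σ R) :=
  Ideal.span (ord.leadingTerm '' (I : Set (MvPolynomial σ R)))

/-- A normalized Gröbner basis: the leading coefficients are units, no leading monomial divides
another one, and the leading terms generate the initial ideal. -/
structure IsNormalizedGroebnerBasis (ord : MonomialOrder σ) (I : Ideal (MvPolynomial σ R))
    (G : Set (MvPolynomial σ R)) : Prop where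
  subset : G ⊆ (I : Set (MvPolynomial σ R))
  isUnit : ∀ f ∈ G, IsUnit (ord.leadingCoeff f)
  irredundant : ∀ f ∈ G, ∀ g ∈ G, ord.degree f ≤ ord.degree g → f = g
  initialIdeal_eq : initialIdeal ord I = Ideal.span (ord.leadingTerm '' G)

/-- The saturation of an ideal with respect to the irrelevant ideal `(X i : i)`, i.e. the saturated
ideal of the closed subscheme of projective space over `R` defined by `J` (when `J` is
homogeneous). The colon ideals form an increasing chain, so the supremum is their union. -/
def saturation (J : Ideal (MvPolynomial σ R)) : Ideal (MvPolynomial σ R) :=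
  ⨆ N : ℕ, Submodule.colon J
    ((Ideal.span (Set.range (X : σ → MvPolynomial σ R)) ^ N : Ideal (MvPolynomial σ R)) :
      Set (MvPolynomial σ R))

end Ideals

section Carpets

/-- The variables `x_0 > … > x_a > y_0 > … > y_b`. -/
abbrev Vars (a b : ℕ) : Type := Fin (a + 1) ⊕ₗ Fin (b + 1)

/-- The polynomial ring `ℤ[x_0, …, x_a, y_0, …, y_b]`. -/
abbrev Poly (a b : ℕ) : Type := MvPolynomial (Vars a b) ℤ

def x {a b : ℕ} (i : Fin (a + 1)) : Poly a b := X (Sum.inlₗ i)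

def y {a b : ℕ} (j : Fin (b + 1)) : Poly a b := X (Sum.inrₗ j)

/-- The matrix with rows `x_0, …, x_{a-1}` and `x_1, …, x_a`. -/
def matrixX (a b : ℕ) : Matrix (Fin 2) (Fin a) (Poly a b) :=
  Matrix.of ![fun i => x i.castSucc, fun i => x i.succ]

/-- The matrix with rows `y_0, …, y_{b-1}` and `y_1, …, y_b`. -/
def matrixY (a b : ℕ) : Matrix (Fin 2) (Fin b) (Poly a b) :=
  Matrix.of ![fun j => y j.castSucc, fun j => y j.succ]

/-- The 2 × 2 minors of a matrix with two rows. -/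
def minors {A : Type} [CommRing A] {n : ℕ} (M : Matrix (Fin 2) (Fin n) A) : Set A :=
  {f | ∃ i j : Fin n, i < j ∧ f = (M.submatrix id ![i, j]).det}

/-- `Q_{i,j} = x_{i+2} y_j - 2 x_{i+1} y_{j+1} + x_i y_{j+2}` for `0 ≤ i ≤ a-2`, `0 ≤ j ≤ b-2`. -/
def bilinearForm (a b : ℕ) (i : Fin (a - 1)) (j : Fin (b - 1)) : Poly a b :=
  x ⟨i + 2, by omega⟩ * y ⟨j, by omega⟩ - 2 * (x ⟨i + 1, by omega⟩ * y ⟨j + 1, by omega⟩)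
    + x ⟨i, by omega⟩ * y ⟨j + 2, by omega⟩

/-- The forms that define the carpet over `ℤ`, for `a, b ≥ 2`. -/
def carpetForms (a b : ℕ) : Set (Poly a b) :=
  minors (matrixX a b) ∪ minors (matrixY a b) ∪ {f | ∃ i j, f = bilinearForm a b i j}

/-- The saturated ideal of the carpet over `ℤ`, for `a, b ≥ 2`. -/
def carpetIdeal (a b : ℕ) : Ideal (Poly a b) :=
  saturation (Ideal.span (carpetForms a b))

end Carpets

section Schreyer

variable {σ : Type} (ord : MonomialOrder σ)

/-- The order in which generators are listed: sorted by degree, and, within one degree, decreasingly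
for the monomial order. `Precedes ord m n` says that `m` is listed before `n`. -/
def Precedes (m n : σ →₀ ℕ) : Prop :=
  m.degree < n.degree ∨ (m.degree = n.degree ∧ ord.toSyn n < ord.toSyn m)

/-- A basis element of the Schreyer resolution is named by a list of monomials (exponent vectors),
the most recent monomial at the head of the list. The basis element with the empty name generates
`F_0`, and `S` is the set of leading monomials of the Gröbner basis.
`schreyerGens ord S w` is the set of all `m` such that `m :: w` is again a name: for `w = []` this
is `S`; otherwise, if `w = m :: w'`, it is the set of minimal monomial generators of the colon ideal
`(t : t a generator for w' listed before m) : m`. -/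
def schreyerGens (S : Set (σ →₀ ℕ)) : List (σ →₀ ℕ) → Set (σ →₀ ℕ)
  | [] => S
  | m :: w =>
    {γ | Minimal (fun δ => ∃ t ∈ schreyerGens S w, Precedes ord t m ∧ t ≤ δ + m) γ}

def IsSchreyerName (S : Set (σ →₀ ℕ)) : List (σ →₀ ℕ) → Prop
  | [] => True
  | m :: w => m ∈ schreyerGens ord S w ∧ IsSchreyerName S w

/-- The basis of the `p`-th free module of the Schreyer resolution. -/
def SchreyerBasis (S : Set (σ →₀ ℕ)) (p : ℕ) : Type :=
  {w : List (σ →₀ ℕ) // w.length = p ∧ IsSchreyerName ord S w}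

variable {ord} {S : Set (σ →₀ ℕ)}

/-- If `d e_u` has leading term `m e_w`, then `m` is the last monomial of the name of `u`. -/
def SchreyerBasis.last {p : ℕ} (u : SchreyerBasis ord S (p + 1)) : σ →₀ ℕ :=
  u.1.head (List.ne_nil_of_length_eq_add_one u.2.1)

theorem SchreyerBasis.parent_aux (p : ℕ) :
    ∀ w : List (σ →₀ ℕ), w.length = p + 1 ∧ IsSchreyerName ord S w →
      w.tail.length = p ∧ IsSchreyerName ord S w.tail
  | [], h => absurd h.1 (by simp)
  | _ :: _, h => ⟨by simpa using h.1, h.2.2⟩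

/-- If `d e_u` has leading term `m e_w`, then the name of `w` is the name of `u` without its last
monomial. -/
def SchreyerBasis.parent {p : ℕ} (u : SchreyerBasis ord S (p + 1)) : SchreyerBasis ord S p :=
  ⟨u.1.tail, SchreyerBasis.parent_aux p u.1 u.2⟩

/-- The internal degree of a basis element: the degree of its name product. -/
def SchreyerBasis.deg {p : ℕ} (u : SchreyerBasis ord S p) : ℕ := u.1.sum.degree

variable (ord)

/-- The induced monomial order on the terms `γ e_w` of the free modules: terms are compared by the
leading terms of their images under the differential; in case of equality the term whose basis
element is listed later is the larger one. `TermLT ord γ w δ v` says `γ e_w < δ e_v`. -/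
def TermLT : (σ →₀ ℕ) → List (σ →₀ ℕ) → (σ →₀ ℕ) → List (σ →₀ ℕ) → Prop
  | γ, [], δ, [] => ord.toSyn γ < ord.toSyn δ
  | γ, m :: w, δ, n :: v =>
    TermLT (γ + m) w (δ + n) v ∨ (γ + m = δ + n ∧ w = v ∧ Precedes ord m n)
  | _, _, _, _ => False

variable (R : Type) [CommRing R]

/-- The free module with the given basis over the polynomial ring. -/
abbrev FreeMod (σ R : Type) [CommRing R] (ι : Type) : Type := ι →₀ MvPolynomial σ R

variable {R}

/-- `d` is the differential of the Schreyer resolution of the monomial ideal with minimal generators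
`S`. The basis element named `[m]`, with `m ∈ S`, is sent to `m`. For `p ≥ 1`, the basis element
with name `m :: w`, where `w` is a name of length `p`, is sent to the syzygy
`m e_w - ∑ g_v e_v` that is obtained from the division with remainder of `m d(e_w)` by the elements
`d(e_v)`: it has leading term `m e_w` for the induced order, and, because at each step of
the division the first `d(e_v)` is used whose leading term divides, no term of `g_v` lies in the
colon ideal that belongs to `v`. -/
structure IsSchreyerResolution (S : Set (σ →₀ ℕ))
    (d : ∀ p : ℕ, FreeMod σ R (SchreyerBasis ord S (p + 1)) →ₗ[MvPolynomial σ R]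
      FreeMod σ R (SchreyerBasis ord S p)) : Prop where
  first : ∀ u : SchreyerBasis ord S 1,
    d 0 (Finsupp.single u 1) = Finsupp.single u.parent (monomial u.last 1)
  syzygy : ∀ (p : ℕ) (u : SchreyerBasis ord S (p + 2)),
    d p (d (p + 1) (Finsupp.single u 1)) = 0 ∧
    ∃ g : FreeMod σ R (SchreyerBasis ord S (p + 1)),
      d (p + 1) (Finsupp.single u 1) = Finsupp.single u.parent (monomial u.last 1) - g ∧
      ∀ v, ∀ γ ∈ (g v).support,
        TermLT ord γ v.1 u.last u.parent.1 ∧ ∀ m ∈ schreyerGens ord S v.1, ¬ m ≤ γ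

end Schreyer

section Resolutions

variable {σ R : Type} [CommRing R]

/-- `⋯ → F_2 → F_1 → F_0 → M → 0` is a minimal graded free resolution over the polynomial ring, where
`F_p` is free on the finite set `ι p` and the basis element `u` has degree `deg p u`. Minimal means
that no matrix entry of a differential has a nonzero constant term. -/
structure IsMinimalFreeResolution {ι : ℕ → Type} (deg : ∀ p, ι p → ℕ)
    (d : ∀ p : ℕ, FreeMod σ R (ι (p + 1)) →ₗ[MvPolynomial σ R] FreeMod σ R (ι p))
    {M : Type} [AddCommGroup M] [Module (MvPolynomial σ R) M]
    (ε : FreeMod σ R (ι 0) →ₗ[MvPolynomial σ R] M) : Prop where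
  finite : ∀ p, Finite (ι p)
  surjective : Function.Surjective ε
  exact_zero : Function.Exact (d 0) ε
  exact_succ : ∀ p, Function.Exact (d (p + 1)) (d p)
  homogeneous : ∀ p (u : ι (p + 1)) (v : ι p),
    ∀ γ ∈ (d p (Finsupp.single u 1) v).support, γ.degree + deg p v = deg (p + 1) u
  minimal : ∀ p (u : ι (p + 1)) (v : ι p),
    constantCoeff (d p (Finsupp.single u 1) v) = 0

/-- The map from `F_0` to the quotient ring `P / J` that sends each basis element to `1`. -/
def augmentation (ι : Type) (J : Ideal (MvPolynomial σ R)) :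
    FreeMod σ R ι →ₗ[MvPolynomial σ R] MvPolynomial σ R ⧸ J :=
  Finsupp.linearCombination (MvPolynomial σ R) (fun _ => (1 : MvPolynomial σ R ⧸ J))

end Resolutions

/-- The reverse lexicographic order with `x_0 > … > x_a > y_0 > … > y_b`. -/
abbrev revLex (a b : ℕ) : MonomialOrder (Vars a b) := degRevLex (Vars a b)

/-- The leading monomials (exponent vectors) of the forms that define the carpet. -/
def leadExps (a b : ℕ) : Set (Vars a b →₀ ℕ) := (revLex a b).degree '' carpetForms a b

end Carpet

end

namespace Carpet

section Reduction

variable {T R V : Type*} [LinearOrder T] [WellFoundedLT T] [CommRing R] [AddCommGroup V]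
  [Module R V] (b : Module.Basis T R V)

/-- Reduction of a basis vector to standard basis vectors, that is, those outside `A`, modulo a
submodule that contains for each index in `A` an element with this leading index. -/
theorem basis_mem_sup_standard (A : Set T) (K : Submodule R V) (τ : T)
    (h : ∀ ρ ≤ τ, ρ ∈ A → ∃ k ∈ K, k - b ρ ∈ Submodule.span R (b '' Set.Iio ρ)) :
    b τ ∈ K ⊔ Submodule.span R (b '' (Aᶜ ∩ Set.Iic τ)) := by
  induction τ using WellFoundedLT.induction with
  | ind τ ih =>
    by_cases hτ : τ ∈ A
    · obtain ⟨k, hk, hkτ⟩ := h τ le_rfl hτ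
      have hle : Submodule.span R (b '' Set.Iio τ) ≤
          K ⊔ Submodule.span R (b '' (Aᶜ ∩ Set.Iic τ)) := by
        rw [Submodule.span_le]
        rintro _ ⟨ρ, hρ, rfl⟩
        have hρ' : ρ < τ := hρ
        refine sup_le_sup_left (Submodule.span_mono (Set.image_mono ?_)) K
          (ih ρ hρ' fun ρ' h' => h ρ' (h'.trans hρ'.le))
        exact Set.inter_subset_inter_right _ (Set.Iic_subset_Iic.2 hρ'.le)
      have := sub_mem (Submodule.mem_sup_left hk) (hle hkτ)
      rwa [sub_sub_cancel] at this
    · exact Submodule.mem_sup_right (Submodule.subset_span ⟨τ, ⟨hτ, le_rfl⟩, rfl⟩)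

theorem mem_sup_standard (A U : Set T) (hU : IsLowerSet U) (K : Submodule R V)
    (h : ∀ ρ ∈ U, ρ ∈ A → ∃ k ∈ K, k - b ρ ∈ Submodule.span R (b '' Set.Iio ρ))
    {z : V} (hz : z ∈ Submodule.span R (b '' U)) :
    z ∈ K ⊔ Submodule.span R (b '' (Aᶜ ∩ U)) := by
  have hle : Submodule.span R (b '' U) ≤ K ⊔ Submodule.span R (b '' (Aᶜ ∩ U)) := by
    rw [Submodule.span_le]
    rintro _ ⟨τ, hτ, rfl⟩
    refine sup_le_sup_left (Submodule.span_mono (Set.image_mono ?_)) K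
      (basis_mem_sup_standard b A K τ fun ρ hρ => h ρ (hU hρ hτ))
    exact Set.inter_subset_inter_right _ fun ρ hρ => hU hρ hτ
  exact hle hz

end Reduction

section BasisSupport

variable {T R V : Type*} [CommRing R] [AddCommGroup V] [Module R V] (b : Module.Basis T R V)

theorem mem_span_image_iff {U : Set T} {z : V} :
    z ∈ Submodule.span R (b '' U) ↔ ∀ τ, b.repr z τ ≠ 0 → τ ∈ U := by
  rw [b.mem_span_image]
  simp [Set.subset_def]

theorem exists_add_of_split (z : V) (U W : Set T) (hz : z ∈ Submodule.span R (b '' U)) :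
    ∃ z₁ ∈ Submodule.span R (b '' (U ∩ W)), ∃ z₂ ∈ Submodule.span R (b '' (U ∩ Wᶜ)),
      z = z₁ + z₂ := by
  have : z ∈ Submodule.span R (b '' (U ∩ W)) ⊔ Submodule.span R (b '' (U ∩ Wᶜ)) := by
    rwa [← Submodule.span_union, ← Set.image_union, Set.inter_union_compl]
  obtain ⟨z₁, h₁, z₂, h₂, h⟩ := Submodule.mem_sup.1 this
  exact ⟨z₁, h₁, z₂, h₂, h.symm⟩

theorem eq_zero_of_mem_span_disjoint {U W : Set T} (h : Disjoint U W) {z : V}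
    (hU : z ∈ Submodule.span R (b '' U)) (hW : z ∈ Submodule.span R (b '' W)) : z = 0 := by
  rw [mem_span_image_iff] at hU hW
  refine b.repr.map_eq_zero_iff.1 (Finsupp.ext fun τ => ?_)
  by_contra hτ
  exact Set.disjoint_left.1 h (hU τ hτ) (hW τ hτ)

end BasisSupport

section TermOrder

variable {σ : Type} (ord : MonomialOrder σ)

theorem Precedes.trans {m n k : σ →₀ ℕ} (h₁ : Precedes ord m n) (h₂ : Precedes ord n k) :
    Precedes ord m k := by
  rcases h₁ with h₁ | ⟨h₁, h₁'⟩ <;> rcases h₂ with h₂ | ⟨h₂, h₂'⟩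
  · exact Or.inl (h₁.trans h₂)
  · exact Or.inl (h₂ ▸ h₁)
  · exact Or.inl (h₁ ▸ h₂)
  · exact Or.inr ⟨h₁.trans h₂, h₂'.trans h₁'⟩

theorem not_precedes_self (m : σ →₀ ℕ) : ¬ Precedes ord m m := by
  rintro (h | ⟨-, h⟩) <;> exact lt_irrefl _ h

theorem precedes_or_eq_or_precedes (m n : σ →₀ ℕ) :
    Precedes ord m n ∨ m = n ∨ Precedes ord n m := by
  rcases lt_trichotomy m.degree n.degree with h | h | h
  · exact Or.inl (Or.inl h)
  · rcases lt_trichotomy (ord.toSyn m) (ord.toSyn n) with h' | h' | h'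
    · exact Or.inr (Or.inr (Or.inr ⟨h.symm, h'⟩))
    · exact Or.inr (Or.inl (ord.toSyn.injective h'))
    · exact Or.inl (Or.inr ⟨h, h'⟩)
  · exact Or.inr (Or.inr (Or.inl h))

theorem finite_setOf_degree_le [Finite σ] (k : ℕ) : {n : σ →₀ ℕ | n.degree ≤ k}.Finite := by
  classical
  cases nonempty_fintype σ
  refine (Set.finite_Icc 0 (Finsupp.equivFunOnFinite.symm fun _ : σ => k)).subset ?_
  exact fun n hn => ⟨fun _ => Nat.zero_le _, fun i => (Finsupp.le_degree i n).trans hn⟩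

theorem precedes_wellFounded [Finite σ] : WellFounded (Precedes ord) := by
  have : IsStrictOrder (σ →₀ ℕ) (Precedes ord) :=
    { irrefl := not_precedes_self ord
      trans := fun _ _ _ => Precedes.trans ord }
  rw [WellFounded.wellFounded_iff_has_min]
  rintro s ⟨m, hm⟩
  have hfin : {n ∈ s | n.degree ≤ m.degree}.Finite :=
    (finite_setOf_degree_le m.degree).subset fun n hn => hn.2
  obtain ⟨n, hn, hmin⟩ := WellFounded.wellFounded_iff_has_min.1
    (hfin.wellFoundedOn (r := Precedes ord)) Set.univ ⟨⟨m, hm, le_rfl⟩, trivial⟩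
  refine ⟨n.1, n.2.1, fun k hk hkn => hmin ⟨k, hk, ?_⟩ trivial hkn⟩
  rcases hkn with h | ⟨h, -⟩
  · exact h.le.trans n.2.2
  · exact h.le.trans n.2.2

theorem TermLT.trans : ∀ {γ δ ε : σ →₀ ℕ} {w v u : List (σ →₀ ℕ)},
    TermLT ord γ w δ v → TermLT ord δ v ε u → TermLT ord γ w ε u
  | _, _, _, [], [], [], h₁, h₂ => lt_trans (α := ord.syn) h₁ h₂
  | _, _, _, _ :: _, _ :: _, _ :: _, h₁, h₂ => by
    rcases h₁ with h₁ | ⟨h₁, rfl, h₁'⟩ <;> rcases h₂ with h₂ | ⟨h₂, rfl, h₂'⟩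
    · exact Or.inl (h₁.trans h₂)
    · exact Or.inl (h₂ ▸ h₁)
    · exact Or.inl (h₁ ▸ h₂)
    · exact Or.inr ⟨h₁.trans h₂, rfl, h₁'.trans ord h₂'⟩

theorem not_termLT_self : ∀ (γ : σ →₀ ℕ) (w : List (σ →₀ ℕ)), ¬ TermLT ord γ w γ w
  | _, [] => lt_irrefl _
  | γ, m :: w => by
    rintro (h | ⟨-, -, h⟩)
    · exact not_termLT_self _ _ h
    · exact not_precedes_self ord _ h

theorem termLT_or_eq_or_termLT : ∀ (γ δ : σ →₀ ℕ) (w v : List (σ →₀ ℕ)), w.length = v.length →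
    TermLT ord γ w δ v ∨ (γ = δ ∧ w = v) ∨ TermLT ord δ v γ w
  | γ, δ, [], [], _ => by
    rcases lt_trichotomy (ord.toSyn γ) (ord.toSyn δ) with h | h | h
    · exact Or.inl h
    · exact Or.inr (Or.inl ⟨ord.toSyn.injective h, rfl⟩)
    · exact Or.inr (Or.inr h)
  | γ, δ, m :: w, n :: v, hl => by
    rcases termLT_or_eq_or_termLT (γ + m) (δ + n) w v (by simpa using hl) with h | ⟨h, rfl⟩ | h
    · exact Or.inl (Or.inl h)
    · rcases precedes_or_eq_or_precedes ord m n with h' | rfl | h'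
      · exact Or.inl (Or.inr ⟨h, rfl, h'⟩)
      · exact Or.inr (Or.inl ⟨add_right_cancel h, rfl⟩)
      · exact Or.inr (Or.inr (Or.inr ⟨h.symm, rfl, h'⟩))
    · exact Or.inr (Or.inr (Or.inl h))

theorem TermLT.add_left : ∀ {γ δ : σ →₀ ℕ} {w v : List (σ →₀ ℕ)} (ε : σ →₀ ℕ),
    TermLT ord γ w δ v → TermLT ord (ε + γ) w (ε + δ) v
  | γ, δ, [], [], ε, h => by
    have h' : ord.toSyn γ < ord.toSyn δ := h
    change ord.toSyn (ε + γ) < ord.toSyn (ε + δ)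
    simpa using h'
  | γ, δ, m :: w, n :: v, ε, h => by
    rcases h with h | ⟨h, rfl, h'⟩
    · refine Or.inl ?_
      rw [add_assoc, add_assoc]
      exact h.add_left ε
    · exact Or.inr ⟨by rw [add_assoc, add_assoc, h], rfl, h'⟩

theorem termLT_wellFounded [Finite σ] (p : ℕ) :
    WellFounded fun τ ρ : (σ →₀ ℕ) × {w : List (σ →₀ ℕ) // w.length = p} =>
      TermLT ord τ.1 τ.2.1 ρ.1 ρ.2.1 := by
  induction p with
  | zero =>
    refine Subrelation.wf ?_ (InvImage.wf (fun τ => ord.toSyn τ.1) (wellFounded_lt (α := ord.syn)))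
    rintro ⟨γ, ⟨w, hw⟩⟩ ⟨δ, ⟨v, hv⟩⟩ h
    obtain rfl := List.eq_nil_of_length_eq_zero hw
    obtain rfl := List.eq_nil_of_length_eq_zero hv
    exact h
  | succ p ih =>
    refine Subrelation.wf ?_ (InvImage.wf
      (fun τ : (σ →₀ ℕ) × {w : List (σ →₀ ℕ) // w.length = p + 1} =>
        (((τ.1 + τ.2.1.head (List.ne_nil_of_length_eq_add_one τ.2.2), ⟨τ.2.1.tail, by
          simp [τ.2.2]⟩) : (σ →₀ ℕ) × {w : List (σ →₀ ℕ) // w.length = p}),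
          τ.2.1.head (List.ne_nil_of_length_eq_add_one τ.2.2)))
      (WellFounded.prod_lex ih (precedes_wellFounded ord)))
    rintro ⟨γ, ⟨_ | ⟨m, w⟩, hw⟩⟩ ⟨δ, ⟨_ | ⟨n, v⟩, hv⟩⟩ h
    · simp at hw
    · simp at hw
    · simp at hv
    · rcases h with h | ⟨h, rfl, h'⟩
      · exact Prod.Lex.left _ _ h
      · change Prod.Lex _ _ (_, _) (_, _)
        simp only [List.head_cons, List.tail_cons, h]
        exact Prod.Lex.right _ h'

end TermOrder

noncomputable section Terms

variable {σ : Type} {ord : MonomialOrder σ} {S : Set (σ →₀ ℕ)} {p : ℕ}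

/-- The basis element with the name `m :: w`. -/
def SchreyerBasis.cons (w : SchreyerBasis ord S p) (m : σ →₀ ℕ) (hm : m ∈ schreyerGens ord S w.1) :
    SchreyerBasis ord S (p + 1) :=
  ⟨m :: w.1, congrArg (· + 1) w.2.1, hm, w.2.2⟩

theorem SchreyerBasis.val_eq_cons (u : SchreyerBasis ord S (p + 1)) :
    u.1 = u.last :: u.parent.1 :=
  (List.cons_head_tail _).symm

theorem SchreyerBasis.last_mem (u : SchreyerBasis ord S (p + 1)) :
    u.last ∈ schreyerGens ord S u.parent.1 := by
  have h := u.2.2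
  rw [u.val_eq_cons] at h
  exact h.1

variable (ord S p) in
/-- The terms `γ e_w` of the `p`-th free module of the Schreyer resolution. -/
@[ext]
structure Term where
  exp : σ →₀ ℕ
  name : SchreyerBasis ord S p

instance : IsStrictTotalOrder (Term ord S p)
    (fun τ ρ => TermLT ord τ.exp τ.name.1 ρ.exp ρ.name.1) where
  irrefl _ := not_termLT_self ord _ _
  trans _ _ _ := TermLT.trans ord
  trichotomous τ ρ h₁ h₂ := by
    rcases termLT_or_eq_or_termLT ord τ.exp ρ.exp τ.name.1 ρ.name.1
      (τ.name.2.1.trans ρ.name.2.1.symm) with h | ⟨h, h'⟩ | h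
    · exact absurd h h₁
    · exact Term.ext h (Subtype.ext h')
    · exact absurd h h₂

open Classical in
instance : LinearOrder (Term ord S p) :=
  linearOrderOfSTO fun τ ρ => TermLT ord τ.exp τ.name.1 ρ.exp ρ.name.1

theorem Term.lt_iff {τ ρ : Term ord S p} :
    τ < ρ ↔ TermLT ord τ.exp τ.name.1 ρ.exp ρ.name.1 := Iff.rfl

instance [Finite σ] : WellFoundedLT (Term ord S p) :=
  ⟨InvImage.wf (fun τ : Term ord S p => (τ.exp, (⟨τ.name.1, τ.name.2.1⟩ : {w : List (σ →₀ ℕ) //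
    w.length = p}))) (termLT_wellFounded ord p)⟩

/-- The product of a monomial and a term. -/
def Term.shift (ε : σ →₀ ℕ) (τ : Term ord S p) : Term ord S p := ⟨ε + τ.exp, τ.name⟩

theorem Term.shift_lt (ε : σ →₀ ℕ) {τ ρ : Term ord S p} (h : τ < ρ) : τ.shift ε < ρ.shift ε :=
  TermLT.add_left ord ε h

/-- The leading term of the image of a term under the differential. -/
def Term.lead (τ : Term ord S (p + 1)) : Term ord S p := ⟨τ.exp + τ.name.last, τ.name.parent⟩

theorem Term.lt_iff_lead {τ ρ : Term ord S (p + 1)} :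
    τ < ρ ↔ τ.lead < ρ.lead ∨ (τ.lead = ρ.lead ∧ Precedes ord τ.name.last ρ.name.last) := by
  have h : τ.lead = ρ.lead ↔
      τ.exp + τ.name.last = ρ.exp + ρ.name.last ∧ τ.name.parent.1 = ρ.name.parent.1 := by
    rw [Term.ext_iff]
    exact and_congr Iff.rfl Subtype.ext_iff
  rw [Term.lt_iff, τ.name.val_eq_cons, ρ.name.val_eq_cons, h, and_assoc]
  exact Iff.rfl

variable (ord S p) in
/-- The terms in the monomial submodule generated by the leading terms of the syzygies. -/
def nonstandard : Set (Term ord S p) := {τ | ∃ m ∈ schreyerGens ord S τ.name.1, m ≤ τ.exp}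

/-- The product of the monomials in a term. -/
def Term.mdeg (τ : Term ord S p) : σ →₀ ℕ := τ.exp + τ.name.1.sum

theorem Term.mdeg_shift (ε : σ →₀ ℕ) (τ : Term ord S p) : (τ.shift ε).mdeg = ε + τ.mdeg :=
  add_assoc _ _ _

theorem nonstandard_of_precedes {τ ρ : Term ord S (p + 1)} (h : τ.lead = ρ.lead)
    (h' : Precedes ord τ.name.last ρ.name.last) : ρ ∈ nonstandard ord S (p + 1) := by
  have h₁ : τ.exp + τ.name.last = ρ.exp + ρ.name.last := congrArg Term.exp h
  have h₂ : τ.name.parent = ρ.name.parent := congrArg Term.name h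
  obtain ⟨m, hm, hmin⟩ := exists_minimal_le_of_wellFoundedLT
    (fun δ => ∃ t ∈ schreyerGens ord S ρ.name.parent.1, Precedes ord t ρ.name.last ∧
      t ≤ δ + ρ.name.last) ρ.exp
    ⟨τ.name.last, h₂ ▸ τ.name.last_mem, h', h₁ ▸ le_add_self⟩
  refine ⟨m, ?_, hm⟩
  rw [ρ.name.val_eq_cons]
  exact hmin

theorem exists_lead_eq_of_mem_schreyerGens (u : SchreyerBasis ord S (p + 1)) {m : σ →₀ ℕ}
    (hm : m ∈ schreyerGens ord S u.1) :
    ∃ ρ : Term ord S (p + 1), ρ < ⟨m, u⟩ ∧ ρ.lead = (⟨m, u⟩ : Term ord S (p + 1)).lead := by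
  rw [u.val_eq_cons] at hm
  obtain ⟨⟨t, ht, htu, hle⟩, -⟩ := hm
  obtain ⟨γ, hγ⟩ := exists_add_of_le hle
  have h : (⟨γ, u.parent.cons t ht⟩ : Term ord S (p + 1)).lead =
      (⟨m, u⟩ : Term ord S (p + 1)).lead :=
    Term.ext ((add_comm _ _).trans hγ.symm) rfl
  exact ⟨_, Term.lt_iff_lead.2 (Or.inr ⟨h, htu⟩), h⟩

end Terms

noncomputable section TermBasis

variable {σ : Type} (ord : MonomialOrder σ) (S : Set (σ →₀ ℕ)) (R : Type) [CommRing R] (p : ℕ)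

/-- The free modules of the Schreyer resolution. -/
abbrev SchreyerModule : Type := FreeMod σ R (SchreyerBasis ord S p)

/-- The terms form a basis over the coefficient ring. -/
def termBasis : Module.Basis (Term ord S p) R (SchreyerModule ord S R p) :=
  (Finsupp.basis fun _ : SchreyerBasis ord S p => basisMonomials σ R).reindex
    ⟨fun τ => ⟨τ.2, τ.1⟩, fun τ => ⟨τ.name, τ.exp⟩, fun _ => rfl, fun _ => rfl⟩

variable {ord S R p}

theorem termBasis_apply (τ : Term ord S p) :
    termBasis ord S R p τ = Finsupp.single τ.name (monomial τ.exp 1) := by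
  simp [termBasis]

theorem termBasis_repr (z : SchreyerModule ord S R p) (τ : Term ord S p) :
    (termBasis ord S R p).repr z τ = coeff τ.exp (z τ.name) := by
  rw [termBasis, Module.Basis.repr_reindex_apply, Finsupp.basis_repr]
  rfl

theorem monomial_smul_termBasis (ε : σ →₀ ℕ) (τ : Term ord S p) :
    (monomial ε (1 : R)) • termBasis ord S R p τ = termBasis ord S R p (τ.shift ε) := by
  rw [termBasis_apply, termBasis_apply, Finsupp.smul_single, smul_eq_mul, monomial_mul, one_mul]
  rfl

theorem monomial_smul_mem_span {U W : Set (Term ord S p)} (ε : σ →₀ ℕ)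
    (h : ∀ τ ∈ U, τ.shift ε ∈ W) {z : SchreyerModule ord S R p}
    (hz : z ∈ Submodule.span R (termBasis ord S R p '' U)) :
    (monomial ε (1 : R)) • z ∈ Submodule.span R (termBasis ord S R p '' W) := by
  have hle : Submodule.span R (termBasis ord S R p '' U) ≤
      (Submodule.span R (termBasis ord S R p '' W)).comap
        (LinearMap.lsmul (MvPolynomial σ R) (SchreyerModule ord S R p)
          (monomial ε 1) |>.restrictScalars R) := by
    rw [Submodule.span_le]
    rintro _ ⟨τ, hτ, rfl⟩
    refine Submodule.subset_span ⟨_, h τ hτ, ?_⟩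
    exact (monomial_smul_termBasis ε τ).symm
  exact hle hz

theorem monomial_smul_mem_span_Iio (ε : σ →₀ ℕ) {τ : Term ord S p} {z : SchreyerModule ord S R p}
    (hz : z ∈ Submodule.span R (termBasis ord S R p '' Set.Iio τ)) :
    (monomial ε (1 : R)) • z ∈ Submodule.span R (termBasis ord S R p '' Set.Iio (τ.shift ε)) :=
  monomial_smul_mem_span ε (fun _ h => Term.shift_lt ε h) hz

end TermBasis

noncomputable section Syzygies

variable {σ : Type} {ord : MonomialOrder σ} {S : Set (σ →₀ ℕ)} {R : Type} [CommRing R] {p : ℕ}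

/-- The images of the basis elements have the leading terms that their names prescribe. -/
def HasLeadingTerms
    (d : SchreyerModule ord S R (p + 1) →ₗ[MvPolynomial σ R] SchreyerModule ord S R p) : Prop :=
  ∀ u : SchreyerBasis ord S (p + 1),
    d (Finsupp.single u 1) - Finsupp.single u.parent (monomial u.last 1) ∈
      Submodule.span R (termBasis ord S R p '' Set.Iio ⟨u.last, u.parent⟩)

/-- The submodule of the elements all of whose terms lie in `U`. -/
abbrev termSpan (R : Type) [CommRing R] (U : Set (Term ord S p)) :
    Submodule R (SchreyerModule ord S R p) :=
  Submodule.span R (termBasis ord S R p '' U)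

theorem termBasis_mem_termSpan {U : Set (Term ord S p)} {τ : Term ord S p} (h : τ ∈ U) :
    termBasis ord S R p τ ∈ termSpan R U :=
  Submodule.subset_span ⟨τ, h, rfl⟩

variable {d : SchreyerModule ord S R (p + 1) →ₗ[MvPolynomial σ R] SchreyerModule ord S R p}

theorem termBasis_eq_smul_single (τ : Term ord S p) :
    termBasis ord S R p τ = (monomial τ.exp (1 : R)) • Finsupp.single τ.name 1 := by
  rw [termBasis_apply, Finsupp.smul_single, smul_eq_mul, mul_one]

theorem HasLeadingTerms.sub_mem (hd : HasLeadingTerms d) (τ : Term ord S (p + 1)) :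
    d (termBasis ord S R (p + 1) τ) - termBasis ord S R p τ.lead ∈ termSpan R (Set.Iio τ.lead) := by
  have h := monomial_smul_mem_span_Iio τ.exp (hd τ.name)
  rw [smul_sub, ← map_smul, ← termBasis_eq_smul_single, Finsupp.smul_single, smul_eq_mul,
    monomial_mul, one_mul] at h
  rwa [termBasis_apply τ.lead]

/-- A nonzero element of the kernel has a nonstandard leading term. -/
theorem HasLeadingTerms.eq_zero (hd : HasLeadingTerms d) {z : SchreyerModule ord S R (p + 1)}
    (hz : d z = 0) (hstd : z ∈ termSpan R (nonstandard ord S (p + 1))ᶜ) : z = 0 := by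
  classical
  by_contra hne
  have hsupp : ((termBasis ord S R (p + 1)).repr z).support.Nonempty := by
    rwa [Finsupp.support_nonempty_iff, Ne, LinearEquiv.map_eq_zero_iff]
  obtain ⟨τ, hτ, hmax⟩ := Finset.exists_max_image _ id hsupp
  have hτA : τ ∉ nonstandard ord S (p + 1) :=
    (mem_span_image_iff _).1 hstd τ (Finsupp.mem_support_iff.1 hτ)
  have hsum : z = ∑ ρ ∈ ((termBasis ord S R (p + 1)).repr z).support,
      (termBasis ord S R (p + 1)).repr z ρ • termBasis ord S R (p + 1) ρ :=
    ((termBasis ord S R (p + 1)).linearCombination_repr z).symm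
  have hcoeff : (termBasis ord S R p).repr (d z) τ.lead =
      (termBasis ord S R (p + 1)).repr z τ := by
    conv_lhs => rw [hsum]
    rw [← LinearMap.coe_restrictScalars R d, map_sum, map_sum, Finsupp.finsetSum_apply,
      Finset.sum_eq_single τ]
    · have h := (mem_span_image_iff _).1 (hd.sub_mem τ) τ.lead
      have h' : (termBasis ord S R p).repr (d (termBasis ord S R (p + 1) τ)) τ.lead = 1 := by
        by_contra h''
        refine lt_irrefl τ.lead (h ?_)
        rwa [map_sub, Finsupp.sub_apply, Module.Basis.repr_self, Finsupp.single_eq_same,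
          sub_ne_zero]
      rw [map_smul, map_smul, Finsupp.smul_apply, LinearMap.coe_restrictScalars, h', smul_eq_mul,
        mul_one]
    · intro ρ hρ hρτ
      have hlt : ρ < τ := lt_of_le_of_ne (hmax ρ hρ) hρτ
      have hlead : ρ.lead < τ.lead := by
        rcases Term.lt_iff_lead.1 hlt with h | ⟨h, h'⟩
        · exact h
        · exact absurd (nonstandard_of_precedes h h') hτA
      have h' : (termBasis ord S R p).repr (d (termBasis ord S R (p + 1) ρ)) τ.lead = 0 := by
        by_contra h''
        refine lt_asymm hlead ((mem_span_image_iff _).1 (hd.sub_mem ρ) τ.lead ?_)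
        rwa [map_sub, Finsupp.sub_apply, Module.Basis.repr_self, Finsupp.single_eq_of_ne hlead.ne',
          sub_zero]
      rw [map_smul, map_smul, Finsupp.smul_apply, LinearMap.coe_restrictScalars, h', smul_zero]
    · intro h
      exact absurd hτ h
  rw [hz, map_zero, Finsupp.zero_apply] at hcoeff
  exact Finsupp.mem_support_iff.1 hτ hcoeff.symm

variable {d' : SchreyerModule ord S R (p + 2) →ₗ[MvPolynomial σ R] SchreyerModule ord S R (p + 1)}

theorem map_eq_zero_of_basis (h : ∀ u, d (d' (Finsupp.single u 1)) = 0)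
    (z : SchreyerModule ord S R (p + 2)) : d (d' z) = 0 := by
  have : d ∘ₗ d' = 0 := Finsupp.lhom_ext' fun u => LinearMap.ext_ring (h u)
  exact LinearMap.congr_fun this z

/-- Exactness, with a bound for the terms of a preimage. -/
theorem mem_map_of_mem_ker [Finite σ] (hd : HasLeadingTerms d) (hd' : HasLeadingTerms d')
    (hdd : ∀ u, d (d' (Finsupp.single u 1)) = 0) {U : Set (Term ord S (p + 1))}
    (hU : IsLowerSet U) {z : SchreyerModule ord S R (p + 1)} (hz : d z = 0)
    (hzU : z ∈ termSpan R U) : ∃ z' ∈ termSpan R {τ | τ.lead ∈ U}, d' z' = z := by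
  have key := mem_sup_standard (termBasis ord S R (p + 1)) (nonstandard ord S (p + 1)) U hU
    ((termSpan R {τ : Term ord S (p + 2) | τ.lead ∈ U}).map (d'.restrictScalars R)) ?_ hzU
  · obtain ⟨k, ⟨z', hz', rfl⟩, g, hg, h⟩ := Submodule.mem_sup.1 key
    have hg0 : g = 0 := by
      refine hd.eq_zero ?_ (Submodule.span_mono (Set.image_mono Set.inter_subset_left) hg)
      have h₁ : g = z - d' z' := by rw [← h]; exact (add_sub_cancel_left _ _).symm
      rw [h₁, map_sub, hz, map_eq_zero_of_basis hdd, sub_zero]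
    refine ⟨z', hz', ?_⟩
    rw [← h, hg0, add_zero]
    rfl
  · rintro ρ hρ ⟨m, hm, hle⟩
    obtain ⟨δ, hδ⟩ := exists_add_of_le hle
    have hlead : (⟨δ, ρ.name.cons m hm⟩ : Term ord S (p + 2)).lead = ρ :=
      Term.ext ((add_comm _ _).trans hδ.symm) rfl
    refine ⟨d' (termBasis ord S R (p + 2) ⟨δ, ρ.name.cons m hm⟩),
      ⟨_, termBasis_mem_termSpan (U := {τ | τ.lead ∈ U}) (by rwa [Set.mem_ofPred_eq, hlead]), rfl⟩,
      ?_⟩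
    have h := hd'.sub_mem ⟨δ, ρ.name.cons m hm⟩
    rwa [hlead] at h

/-- Each of the minimal generators occurs as the leading monomial of an element of the kernel. -/
def HasLeadingSyzygies
    (d : SchreyerModule ord S R (p + 1) →ₗ[MvPolynomial σ R] SchreyerModule ord S R p) : Prop :=
  ∀ (u : SchreyerBasis ord S (p + 1)), ∀ m ∈ schreyerGens ord S u.1,
    ∃ k, d k = 0 ∧ k - termBasis ord S R (p + 1) ⟨m, u⟩ ∈ termSpan R (Set.Iio ⟨m, u⟩)

theorem HasLeadingSyzygies.zero
    {d : SchreyerModule ord S R 1 →ₗ[MvPolynomial σ R] SchreyerModule ord S R 0}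
    (hd : ∀ u : SchreyerBasis ord S 1,
      d (Finsupp.single u 1) = Finsupp.single u.parent (monomial u.last 1)) :
    HasLeadingSyzygies d := by
  intro u m hm
  obtain ⟨ρ, hρ, hlead⟩ := exists_lead_eq_of_mem_schreyerGens u hm
  have h : ∀ τ, d (termBasis ord S R 1 τ) = termBasis ord S R 0 τ.lead := by
    intro τ
    rw [termBasis_eq_smul_single, map_smul, hd, Finsupp.smul_single, smul_eq_mul, monomial_mul,
      one_mul, termBasis_apply]
    rfl
  refine ⟨termBasis ord S R 1 ⟨m, u⟩ - termBasis ord S R 1 ρ, ?_, ?_⟩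
  · rw [map_sub, h, h, hlead, sub_self]
  · rw [sub_sub_cancel_left]
    exact neg_mem (termBasis_mem_termSpan hρ)

theorem HasLeadingSyzygies.succ [Finite σ] (hd : HasLeadingTerms d) (hd' : HasLeadingTerms d')
    (hdd : ∀ u, d (d' (Finsupp.single u 1)) = 0) : HasLeadingSyzygies d' := by
  intro u m hm
  obtain ⟨ρ, hρ, hlead⟩ := exists_lead_eq_of_mem_schreyerGens u hm
  set τ : Term ord S (p + 2) := ⟨m, u⟩
  obtain ⟨z', hz', h⟩ := mem_map_of_mem_ker hd hd' hdd (isLowerSet_Iio τ.lead)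
    (z := d' (termBasis ord S R (p + 2) τ - termBasis ord S R (p + 2) ρ))
    (map_eq_zero_of_basis hdd _) (by
      have h₁ := hd'.sub_mem τ
      have h₂ := hd'.sub_mem ρ
      rw [hlead] at h₂
      have := sub_mem h₁ h₂
      rwa [sub_sub_sub_cancel_right, ← map_sub] at this)
  refine ⟨termBasis ord S R (p + 2) τ - termBasis ord S R (p + 2) ρ - z', ?_, ?_⟩
  · rw [map_sub, h, sub_self]
  · have h₁ : ∀ x y z : SchreyerModule ord S R (p + 2), x - y - z - x = -(y + z) :=
      fun x y z => by abel
    refine (h₁ _ _ _).symm ▸ neg_mem (add_mem (termBasis_mem_termSpan hρ)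
      (Submodule.span_mono (Set.image_mono ?_) hz'))
    exact fun ρ' h' => Term.lt_iff_lead.2 (Or.inl h')

/-- The condition on a basis element that defines the next differential. -/
def IsSchreyerSyzygy
    (d : SchreyerModule ord S R (p + 1) →ₗ[MvPolynomial σ R] SchreyerModule ord S R p)
    (u : SchreyerBasis ord S (p + 2)) (z : SchreyerModule ord S R (p + 1)) : Prop :=
  d z = 0 ∧ ∃ g : SchreyerModule ord S R (p + 1),
    z = Finsupp.single u.parent (monomial u.last 1) - g ∧
    ∀ v, ∀ γ ∈ (g v).support,
      TermLT ord γ v.1 u.last u.parent.1 ∧ ∀ m ∈ schreyerGens ord S v.1, ¬ m ≤ γ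

theorem mem_termSpan_standard_iff (τ : Term ord S p) (g : SchreyerModule ord S R p) :
    g ∈ termSpan R ((nonstandard ord S p)ᶜ ∩ Set.Iio τ) ↔
      ∀ v, ∀ γ ∈ (g v).support,
        TermLT ord γ v.1 τ.exp τ.name.1 ∧ ∀ m ∈ schreyerGens ord S v.1, ¬ m ≤ γ := by
  rw [mem_span_image_iff]
  constructor
  · intro h v γ hγ
    obtain ⟨h₁, h₂⟩ := h ⟨γ, v⟩ (by rw [termBasis_repr]; exact mem_support_iff.1 hγ)
    exact ⟨h₂, fun m hm hle => h₁ ⟨m, hm, hle⟩⟩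
  · intro h ρ hρ
    rw [termBasis_repr] at hρ
    obtain ⟨h₁, h₂⟩ := h ρ.name ρ.exp (mem_support_iff.2 hρ)
    exact ⟨fun ⟨m, hm, hle⟩ => h₂ m hm hle, h₁⟩

theorem isSchreyerSyzygy_iff (u : SchreyerBasis ord S (p + 2))
    (z : SchreyerModule ord S R (p + 1)) : IsSchreyerSyzygy d u z ↔ d z = 0 ∧
      Finsupp.single u.parent (monomial u.last 1) - z ∈
        termSpan R ((nonstandard ord S (p + 1))ᶜ ∩ Set.Iio ⟨u.last, u.parent⟩) := by
  refine and_congr Iff.rfl ?_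
  rw [mem_termSpan_standard_iff]
  constructor
  · rintro ⟨g, rfl, hg⟩
    rwa [sub_sub_cancel]
  · intro h
    exact ⟨_, (sub_sub_cancel _ _).symm, h⟩

theorem HasLeadingSyzygies.exists_isSchreyerSyzygy [Finite σ] (hd : HasLeadingSyzygies d)
    (u : SchreyerBasis ord S (p + 2)) : ∃ z, IsSchreyerSyzygy d u z := by
  obtain ⟨k, hk, hku⟩ := hd u.parent u.last u.last_mem
  have key := mem_sup_standard (termBasis ord S R (p + 1)) (nonstandard ord S (p + 1)) _
    (isLowerSet_Iio _) ((LinearMap.ker d).restrictScalars R) ?_ hku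
  · obtain ⟨k', hk', g, hg, h⟩ := Submodule.mem_sup.1 key
    refine ⟨k - k', (isSchreyerSyzygy_iff u _).2 ⟨?_, ?_⟩⟩
    · rw [map_sub, hk, show d k' = 0 from hk', sub_zero]
    · rw [← termBasis_apply ⟨u.last, u.parent⟩, ← neg_mem_iff]
      convert hg using 1
      rw [eq_sub_of_add_eq' h]
      abel
  · rintro ρ - ⟨m, hm, hle⟩
    obtain ⟨δ, hδ⟩ := exists_add_of_le hle
    obtain ⟨k, hk, hkm⟩ := hd ρ.name m hm
    have hshift : (⟨m, ρ.name⟩ : Term ord S (p + 1)).shift δ = ρ :=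
      Term.ext ((add_comm _ _).trans hδ.symm) rfl
    refine ⟨(monomial δ (1 : R)) • k, ?_, ?_⟩
    · change d _ = 0
      rw [map_smul, hk, smul_zero]
    · have h := monomial_smul_mem_span_Iio δ hkm
      rwa [smul_sub, monomial_smul_termBasis, hshift] at h

theorem hasLeadingTerms_of_isSchreyerSyzygy
    (h : ∀ u, IsSchreyerSyzygy d u (d' (Finsupp.single u 1))) : HasLeadingTerms d' := by
  intro u
  rw [← neg_mem_iff, neg_sub]
  exact Submodule.span_mono (Set.image_mono Set.inter_subset_right)
    ((isSchreyerSyzygy_iff u _).1 (h u)).2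

theorem HasLeadingSyzygies.exists_next [Finite σ] (hd : HasLeadingTerms d)
    (hd' : HasLeadingSyzygies d) :
    ∃ d' : SchreyerModule ord S R (p + 2) →ₗ[MvPolynomial σ R] SchreyerModule ord S R (p + 1),
      (HasLeadingTerms d' ∧ HasLeadingSyzygies d') ∧
      ∀ u, IsSchreyerSyzygy d u (d' (Finsupp.single u 1)) := by
  choose z hz using hd'.exists_isSchreyerSyzygy
  have h : ∀ u, Finsupp.linearCombination (MvPolynomial σ R) z (Finsupp.single u 1) = z u := by
    simp
  have h₁ : ∀ u, IsSchreyerSyzygy d u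
      (Finsupp.linearCombination (MvPolynomial σ R) z (Finsupp.single u 1)) := by
    intro u
    rw [h]
    exact hz u
  have h₂ := hasLeadingTerms_of_isSchreyerSyzygy h₁
  exact ⟨Finsupp.linearCombination (MvPolynomial σ R) z,
    ⟨h₂, HasLeadingSyzygies.succ hd h₂ fun u => (h₁ u).1⟩, h₁⟩

variable (ord S R) in
/-- The Schreyer resolution exists. -/
theorem exists_isSchreyerResolution [Finite σ] :
    ∃ d, IsSchreyerResolution (R := R) ord S d := by
  let X : ℕ → Type := fun p =>
    {d : SchreyerModule ord S R (p + 1) →ₗ[MvPolynomial σ R] SchreyerModule ord S R p //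
      HasLeadingTerms d ∧ HasLeadingSyzygies d}
  let d₀ : SchreyerModule ord S R 1 →ₗ[MvPolynomial σ R] SchreyerModule ord S R 0 :=
    Finsupp.linearCombination (MvPolynomial σ R) fun u : SchreyerBasis ord S 1 =>
      (Finsupp.single u.parent (monomial u.last 1) : SchreyerModule ord S R 0)
  have h₀ : ∀ u : SchreyerBasis ord S 1,
      d₀ (Finsupp.single u 1) = Finsupp.single u.parent (monomial u.last 1) := by
    simp [d₀]
  have h₀' : HasLeadingTerms d₀ := by
    intro u
    rw [h₀, sub_self]
    exact zero_mem _
  let next : ∀ p, X p → X (p + 1) := fun p d =>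
    ⟨(d.2.2.exists_next d.2.1).choose, (d.2.2.exists_next d.2.1).choose_spec.1⟩
  let x : ∀ p, X p := fun p => Nat.rec ⟨d₀, h₀', HasLeadingSyzygies.zero h₀⟩ next p
  exact ⟨fun p => (x p).1, h₀, fun p u => ((x p).2.2.exists_next (x p).2.1).choose_spec.2 u⟩

end Syzygies

section Exactness

variable {σ : Type} {ord : MonomialOrder σ} {S : Set (σ →₀ ℕ)} {R : Type} [CommRing R]
  {d : ∀ p : ℕ, SchreyerModule ord S R (p + 1) →ₗ[MvPolynomial σ R] SchreyerModule ord S R p}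

theorem IsSchreyerResolution.hasLeadingTerms (h : IsSchreyerResolution ord S d) :
    ∀ p, HasLeadingTerms (d p)
  | 0 => fun u => by rw [h.first, sub_self]; exact zero_mem _
  | p + 1 => hasLeadingTerms_of_isSchreyerSyzygy (h.syzygy p)

theorem IsSchreyerResolution.exact_succ [Finite σ] (h : IsSchreyerResolution ord S d) (p : ℕ) :
    Function.Exact (d (p + 1)) (d p) := by
  refine fun z => ⟨fun hz => ?_, ?_⟩
  · obtain ⟨z', -, hz'⟩ := mem_map_of_mem_ker (h.hasLeadingTerms p) (h.hasLeadingTerms (p + 1))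
      (fun u => (h.syzygy p u).1) isLowerSet_univ hz ((mem_span_image_iff _).2 fun _ _ => trivial)
    exact ⟨z', hz'⟩
  · rintro ⟨z', rfl⟩
    exact map_eq_zero_of_basis (fun u => (h.syzygy p u).1) z'

theorem map_mem_termSpan_mdeg {p : ℕ}
    {d : SchreyerModule ord S R (p + 1) →ₗ[MvPolynomial σ R] SchreyerModule ord S R p}
    (hd : ∀ u : SchreyerBasis ord S (p + 1),
      d (Finsupp.single u 1) ∈ termSpan R {τ | τ.mdeg = u.1.sum})
    (A B : Set (σ →₀ ℕ)) (hAB : A ⊆ B) {z : SchreyerModule ord S R (p + 1)}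
    (hz : z ∈ termSpan R {τ | τ.mdeg ∈ A}) : d z ∈ termSpan R {τ | τ.mdeg ∈ B} := by
  have hle : termSpan R {τ : Term ord S (p + 1) | τ.mdeg ∈ A} ≤
      Submodule.comap (d.restrictScalars R) (termSpan R {τ : Term ord S p | τ.mdeg ∈ B}) := by
    rw [Submodule.span_le]
    rintro _ ⟨τ, hτ, rfl⟩
    change d _ ∈ termSpan R _
    rw [termBasis_eq_smul_single, map_smul]
    refine monomial_smul_mem_span τ.exp ?_ (hd τ.name)
    intro ρ hρ
    change (ρ.shift τ.exp).mdeg ∈ B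
    rw [Term.mdeg_shift, show ρ.mdeg = _ from hρ]
    exact hAB hτ
  exact hle hz

/-- The differentials respect the grading by exponent vectors. -/
theorem IsSchreyerResolution.mem_termSpan_mdeg (h : IsSchreyerResolution ord S d) (p : ℕ) :
    ∀ u : SchreyerBasis ord S (p + 1),
      d p (Finsupp.single u 1) ∈ termSpan R {τ | τ.mdeg = u.1.sum} := by
  induction p with
  | zero =>
    intro u
    rw [h.first, ← termBasis_apply ⟨u.last, u.parent⟩]
    refine termBasis_mem_termSpan ?_
    rw [u.val_eq_cons, List.sum_cons]
    rfl
  | succ p ih =>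
    intro u
    obtain ⟨hz, hg⟩ := (isSchreyerSyzygy_iff u _).1 (h.syzygy p u)
    set z := d (p + 1) (Finsupp.single u 1)
    set e := termBasis ord S R (p + 1) ⟨u.last, u.parent⟩ with he
    rw [← termBasis_apply ⟨u.last, u.parent⟩, ← he] at hg
    set W : Set (Term ord S (p + 1)) := {τ | τ.mdeg = u.1.sum}
    have heW : e ∈ termSpan R W := by
      refine termBasis_mem_termSpan ?_
      change _ = _
      rw [u.val_eq_cons, List.sum_cons]
      rfl
    obtain ⟨g₁, hg₁, g₂, hg₂, hsum⟩ := exists_add_of_split _ _ _ W hg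
    have hg₁' : g₁ ∈ termSpan R W := Submodule.span_mono (Set.image_mono Set.inter_subset_right) hg₁
    have hg₂' : g₂ ∈ termSpan R Wᶜ :=
      Submodule.span_mono (Set.image_mono Set.inter_subset_right) hg₂
    have hdeq : d p g₂ = d p (e - g₁) := by
      have h₁ : g₂ = e - g₁ - z := by rw [sub_right_comm, hsum, add_sub_cancel_left]
      rw [h₁, map_sub, hz, sub_zero]
    have h0 : d p g₂ = 0 := by
      refine eq_zero_of_mem_span_disjoint (termBasis ord S R p)
        (U := {τ | τ.mdeg ∈ ({u.1.sum} : Set (σ →₀ ℕ))})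
        (W := {τ | τ.mdeg ∈ ({u.1.sum} : Set (σ →₀ ℕ))ᶜ}) ?_ ?_ ?_
      · exact Set.disjoint_left.2 fun τ h₁ h₂ => h₂ h₁
      · rw [hdeq]
        exact map_mem_termSpan_mdeg ih _ _ subset_rfl (sub_mem heW hg₁')
      · exact map_mem_termSpan_mdeg ih _ _ subset_rfl hg₂'
    have hg₂0 : g₂ = 0 := (h.hasLeadingTerms p).eq_zero h0
      (Submodule.span_mono (Set.image_mono fun τ hτ => hτ.1.1) hg₂)
    have hzeq : z = e - g₁ := by
      rw [hg₂0, add_zero] at hsum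
      rw [← hsum, sub_sub_cancel]
    rw [hzeq]
    exact sub_mem heW hg₁'

theorem IsSchreyerResolution.exp_add_sum (h : IsSchreyerResolution ord S d) (p : ℕ)
    (u : SchreyerBasis ord S (p + 1)) (v : SchreyerBasis ord S p) (γ : σ →₀ ℕ)
    (hγ : γ ∈ (d p (Finsupp.single u 1) v).support) : γ + v.1.sum = u.1.sum :=
  (mem_span_image_iff _).1 (h.mem_termSpan_mdeg p u) ⟨γ, v⟩
    (by rw [termBasis_repr]; exact mem_support_iff.1 hγ)

theorem finite_schreyerGens [Finite σ] (hS : S.Finite) :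
    ∀ w : List (σ →₀ ℕ), (schreyerGens ord S w).Finite
  | [] => hS
  | _ :: _ => (setOfPred_minimal_antichain _).finite_of_partiallyWellOrderedOn
      (Set.partiallyWellOrderedOn_of_wellQuasiOrdered wellQuasiOrdered_le _)

theorem SchreyerBasis.zero_eq (u v : SchreyerBasis ord S 0) : u = v :=
  Subtype.ext ((List.eq_nil_of_length_eq_zero u.2.1).trans
    (List.eq_nil_of_length_eq_zero v.2.1).symm)

theorem finite_schreyerBasis [Finite σ] (hS : S.Finite) (p : ℕ) :
    Finite (SchreyerBasis ord S p) := by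
  induction p with
  | zero =>
    exact Finite.of_injective (fun _ => ()) fun u v _ => u.zero_eq v
  | succ p ih =>
    have : ∀ w : SchreyerBasis ord S p, Finite (schreyerGens ord S w.1) := fun w =>
      finite_schreyerGens hS w.1
    refine Finite.of_injective (β := Σ w : SchreyerBasis ord S p, schreyerGens ord S w.1)
      (fun u => ⟨u.parent, u.last, u.last_mem⟩) ?_
    intro u v huv
    have h₁ : u.parent = v.parent := congrArg Sigma.fst huv
    have h₂ : u.last = v.last :=
      congrArg (fun s : Σ w : SchreyerBasis ord S p, schreyerGens ord S w.1 => s.2.1) huv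
    refine Subtype.ext ?_
    rw [u.val_eq_cons, v.val_eq_cons, h₁, h₂]

theorem augmentation_single (J : Ideal (MvPolynomial σ R)) (u : SchreyerBasis ord S 0)
    (f : MvPolynomial σ R) :
    augmentation (SchreyerBasis ord S 0) J (Finsupp.single u f) = Ideal.Quotient.mk J f := by
  rw [augmentation, Finsupp.linearCombination_single]
  exact congrArg (Ideal.Quotient.mk J) (mul_one f)

theorem IsSchreyerResolution.exact_augmentation (h : IsSchreyerResolution ord S d)
    (J : Ideal (MvPolynomial σ R)) (hJ : J = Ideal.span ((fun m => monomial m (1 : R)) '' S)) :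
    Function.Exact (d 0) (augmentation (SchreyerBasis ord S 0) J) := by
  have hJS : ∀ m ∈ S, monomial m (1 : R) ∈ J := fun m hm => hJ ▸ Ideal.subset_span ⟨m, hm, rfl⟩
  set u₀ : SchreyerBasis ord S 0 := ⟨[], rfl, trivial⟩ with hu₀
  refine fun z => ⟨fun hz => ?_, ?_⟩
  · have hz' : z = Finsupp.single u₀ (z u₀) := by
      ext1 v
      rw [SchreyerBasis.zero_eq v u₀, Finsupp.single_eq_same]
    have hle : J ≤ (LinearMap.range (d 0)).comap (Finsupp.lsingle u₀) := by
      rw [hJ, Ideal.span_le]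
      rintro _ ⟨m, hm, rfl⟩
      exact ⟨Finsupp.single (u₀.cons m hm) 1, h.first _⟩
    rw [hz'] at hz ⊢
    rw [augmentation_single, Ideal.Quotient.eq_zero_iff_mem] at hz
    exact hle hz
  · rintro ⟨z', rfl⟩
    have h0 : augmentation (SchreyerBasis ord S 0) J ∘ₗ d 0 = 0 := by
      refine Finsupp.lhom_ext' fun u => LinearMap.ext_ring ?_
      change augmentation _ J (d 0 (Finsupp.single u 1)) = 0
      rw [h.first, augmentation_single, Ideal.Quotient.eq_zero_iff_mem]
      refine hJS _ ?_
      have := u.last_mem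
      rwa [SchreyerBasis.zero_eq u.parent u₀] at this
    exact LinearMap.congr_fun h0 z'

/-- The Schreyer resolution is a graded free resolution; it is minimal if the multidegree of a basis
element determines its homological degree. -/
theorem IsSchreyerResolution.isMinimalFreeResolution [Finite σ] (h : IsSchreyerResolution ord S d)
    (hS : S.Finite) (J : Ideal (MvPolynomial σ R))
    (hJ : J = Ideal.span ((fun m => monomial m (1 : R)) '' S))
    (hmin : ∀ p (u : SchreyerBasis ord S (p + 1)) (v : SchreyerBasis ord S p),
      u.1.sum ≠ v.1.sum) :
    IsMinimalFreeResolution (ι := SchreyerBasis ord S) (fun _ u => u.deg) d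
      (augmentation _ J) where
  finite := finite_schreyerBasis hS
  surjective := by
    intro q
    obtain ⟨f, rfl⟩ := Ideal.Quotient.mk_surjective q
    exact ⟨Finsupp.single ⟨[], rfl, trivial⟩ f, augmentation_single J _ f⟩
  exact_zero := h.exact_augmentation J hJ
  exact_succ := h.exact_succ
  homogeneous p u v γ hγ := by
    have := h.exp_add_sum p u v γ hγ
    rw [SchreyerBasis.deg, SchreyerBasis.deg, ← this, map_add]
  minimal p u v := by
    by_contra h0
    have := h.exp_add_sum p u v 0 (mem_support_iff.2 h0)
    rw [zero_add] at this
    exact hmin p u v this.symm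

end Exactness

section Pairs

variable {σ : Type}

/-- The exponent vector of the product of two variables. -/
noncomputable def pairExp (p q : σ) : σ →₀ ℕ := Finsupp.single p 1 + Finsupp.single q 1

theorem degree_pairExp (p q : σ) : (pairExp p q).degree = 2 := by
  simp [pairExp]

theorem pairExp_eq_of_le {p q r s : σ} (h : pairExp p q ≤ pairExp r s) :
    pairExp p q = pairExp r s := by
  obtain ⟨γ, hγ⟩ := exists_add_of_le h
  have h₁ := congrArg Finsupp.degree hγ
  rw [map_add, degree_pairExp, degree_pairExp] at h₁
  have h₂ : γ = 0 := (Finsupp.degree_eq_zero_iff γ).1 (by omega)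
  rw [hγ, h₂, add_zero]

variable [LinearOrder σ] [Fintype σ]

theorem toSyn_pairExp_lt {p q r s : σ} (hpq : p ≤ q) (hrs : r ≤ s)
    (h : q < s ∨ (q = s ∧ p < r)) :
    (degRevLex σ).toSyn (pairExp r s) < (degRevLex σ).toSyn (pairExp p q) := by
  rw [degRevLex_toSyn_lt_iff, degree_pairExp, degree_pairExp]
  refine Or.inr ⟨rfl, ?_⟩
  simp only [pairExp, Finsupp.add_apply]
  rcases h with h | ⟨rfl, h⟩
  · refine ⟨s, fun j hj => ?_, ?_⟩
    · rw [Finsupp.single_eq_of_ne, Finsupp.single_eq_of_ne, Finsupp.single_eq_of_ne,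
        Finsupp.single_eq_of_ne]
      all_goals intro h; subst h; order
    · rw [Finsupp.single_eq_of_ne (by rintro rfl; order : s ≠ p),
        Finsupp.single_eq_of_ne (by rintro rfl; order : s ≠ q), Finsupp.single_eq_same]
      omega
  · refine ⟨r, fun j hj => ?_, ?_⟩
    · rw [Finsupp.single_eq_of_ne (by rintro rfl; order : j ≠ r),
        Finsupp.single_eq_of_ne (by rintro rfl; order : j ≠ p)]
    · rw [Finsupp.single_eq_of_ne (by rintro rfl; order : r ≠ p), Finsupp.single_eq_same]
      omega

theorem precedes_pairExp_iff {p q r s : σ} (hpq : p ≤ q) (hrs : r ≤ s) :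
    Precedes (degRevLex σ) (pairExp p q) (pairExp r s) ↔ q < s ∨ (q = s ∧ p < r) := by
  rw [Precedes, degree_pairExp, degree_pairExp]
  constructor
  · rintro (h | ⟨-, h⟩)
    · exact absurd h (lt_irrefl 2)
    · by_contra h'
      rw [not_or, not_and, not_lt, not_lt] at h'
      rcases h'.1.lt_or_eq with h₁ | rfl
      · exact lt_asymm h (toSyn_pairExp_lt hrs hpq (Or.inl h₁))
      · rcases (h'.2 rfl).lt_or_eq with h₁ | rfl
        · exact lt_asymm h (toSyn_pairExp_lt hrs hpq (Or.inr ⟨rfl, h₁⟩))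
        · exact lt_irrefl _ h
  · exact fun h => Or.inr ⟨rfl, toSyn_pairExp_lt hpq hrs h⟩

theorem pairExp_inj {p q r s : σ} (hpq : p ≤ q) (hrs : r ≤ s) (h : pairExp p q = pairExp r s) :
    p = r ∧ q = s := by
  have h₁ := not_precedes_self (degRevLex σ) (pairExp p q)
  have h₂ := h₁
  nth_rewrite 2 [h] at h₁
  nth_rewrite 1 [h] at h₂
  rw [precedes_pairExp_iff hpq hrs] at h₁
  rw [precedes_pairExp_iff hrs hpq] at h₂
  rcases lt_trichotomy q s with h | rfl | h
  · exact absurd (Or.inl h) h₁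
  · rcases lt_trichotomy p r with h | rfl | h
    · exact absurd (Or.inr ⟨rfl, h⟩) h₁
    · exact ⟨rfl, rfl⟩
    · exact absurd (Or.inr ⟨rfl, h⟩) h₂
  · exact absurd (Or.inl h) h₂

theorem precedes_single_iff {p q : σ} :
    Precedes (degRevLex σ) (Finsupp.single p 1) (Finsupp.single q 1) ↔ p < q := by
  have h : ∀ {p q : σ}, p < q →
      (degRevLex σ).toSyn (Finsupp.single q 1) < (degRevLex σ).toSyn (Finsupp.single p 1) := by
    intro p q hpq
    rw [degRevLex_toSyn_lt_iff, Finsupp.degree_single, Finsupp.degree_single]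
    refine Or.inr ⟨rfl, q, fun j hj => ?_, ?_⟩
    · rw [Finsupp.single_eq_of_ne (by rintro rfl; order : j ≠ p),
        Finsupp.single_eq_of_ne (by rintro rfl; order : j ≠ q)]
    · rw [Finsupp.single_eq_of_ne (by rintro rfl; order : q ≠ p), Finsupp.single_eq_same]
      omega
  rw [Precedes, Finsupp.degree_single, Finsupp.degree_single]
  constructor
  · rintro (h' | ⟨-, h'⟩)
    · exact absurd h' (lt_irrefl 1)
    · rcases lt_trichotomy p q with h₁ | rfl | h₁
      · exact h₁
      · exact absurd h' (lt_irrefl _)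
      · exact absurd h' (lt_asymm (h h₁))
  · exact fun h' => Or.inr ⟨rfl, h h'⟩

end Pairs

section Groebner

variable {σ : Type} (ord : MonomialOrder σ) {R : Type} [CommRing R]

theorem degree_leadingCoeff_of_lt [Nontrivial R] {f g : MvPolynomial σ R} {μ : σ →₀ ℕ} {c : R}
    (hc : IsUnit c) (hf : f = monomial μ c + g)
    (hg : ∀ ν ∈ g.support, ord.toSyn ν < ord.toSyn μ) (hμ : ord.toSyn 0 < ord.toSyn μ) :
    ord.degree f = μ ∧ ord.leadingCoeff f = c := by
  classical
  have h : ord.degree (monomial μ c) = μ := by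
    rw [MonomialOrder.degree_monomial, if_neg hc.ne_zero]
  have hlt : ord.toSyn (ord.degree g) < ord.toSyn (ord.degree (monomial μ c)) := by
    rw [h]
    exact (MonomialOrder.degree_lt_iff hμ).2 hg
  subst hf
  refine ⟨(MonomialOrder.degree_add_of_lt hlt).trans h, ?_⟩
  rw [MonomialOrder.leadingCoeff_add_of_lt hlt, MonomialOrder.leadingCoeff_monomial]

theorem groebner_of_standard_independent {G : Set (MvPolynomial σ R)}
    {K : Ideal (MvPolynomial σ R)} (hGK : G ⊆ K) (hG : ∀ f ∈ G, IsUnit (ord.leadingCoeff f))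
    (hK : ∀ f ∈ K, (∀ α ∈ f.support, ∀ g ∈ G, ¬ ord.degree g ≤ α) → f = 0) :
    K = Ideal.span G ∧ initialIdeal ord K = Ideal.span (ord.leadingTerm '' G) := by
  have key : ∀ f ∈ K, ∃ g : G →₀ MvPolynomial σ R,
      f = Finsupp.linearCombination _ (fun b : G => (b : MvPolynomial σ R)) g ∧
      ∀ b : G, ord.toSyn (ord.degree ((b : MvPolynomial σ R) * g b)) ≤
        ord.toSyn (ord.degree f) := by
    intro f hf
    obtain ⟨g, r, hfr, hdeg, hr⟩ := ord.div_set hG f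
    have hlin : Finsupp.linearCombination _ (fun b : G => (b : MvPolynomial σ R)) g ∈ K := by
      rw [Finsupp.linearCombination_apply]
      exact sum_mem fun b _ => K.mul_mem_left _ (hGK b.2)
    have hrK : r ∈ K := by
      have := sub_mem hf hlin
      rwa [hfr, add_sub_cancel_left] at this
    have hr0 : r = 0 := hK r hrK hr
    exact ⟨g, by rw [hfr, hr0, add_zero], hdeg⟩
  refine ⟨le_antisymm (fun f hf => ?_) (Ideal.span_le.2 hGK), le_antisymm ?_ ?_⟩
  · obtain ⟨g, rfl, -⟩ := key f hf
    rw [Finsupp.linearCombination_apply]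
    exact sum_mem fun b _ => Ideal.mul_mem_left _ _ (Ideal.subset_span b.2)
  · refine Ideal.span_le.2 ?_
    rintro _ ⟨f, hf, rfl⟩
    rcases eq_or_ne f 0 with rfl | hf0
    · rw [MonomialOrder.leadingTerm_zero]
      exact zero_mem _
    obtain ⟨g, hfg, hdeg⟩ := key f hf
    have hcoeff : ord.leadingCoeff f ≠ 0 := MonomialOrder.leadingCoeff_ne_zero_iff.2 hf0
    obtain ⟨b, hb⟩ : ∃ b : G, coeff (ord.degree f) ((b : MvPolynomial σ R) * g b) ≠ 0 := by
      by_contra! h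
      refine hcoeff ?_
      rw [MonomialOrder.leadingCoeff]
      nth_rewrite 2 [hfg]
      rw [Finsupp.linearCombination_apply, Finsupp.sum, coeff_sum]
      exact Finset.sum_eq_zero fun b _ => by rw [smul_eq_mul, mul_comm, h b]
    have hgb : g b ≠ 0 := fun h0 => hb (by rw [h0, mul_zero, coeff_zero])
    have hd : ord.degree f = ord.degree (b : MvPolynomial σ R) + ord.degree (g b) := by
      rw [← MonomialOrder.degree_mul_of_isRegular_left (hG b b.2).isRegular hgb]
      exact ord.toSyn.injective
        (le_antisymm (MonomialOrder.le_degree (mem_support_iff.2 hb)) (hdeg b))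
    have heq : ord.leadingTerm f = monomial (ord.degree (g b))
        (ord.leadingCoeff f * ((hG b b.2).unit⁻¹ : Rˣ)) * ord.leadingTerm b.1 := by
      rw [MonomialOrder.leadingTerm, MonomialOrder.leadingTerm, monomial_mul, hd, mul_assoc,
        add_comm]
      simp
    rw [heq]
    exact Ideal.mul_mem_left _ _ (Ideal.subset_span ⟨b.1, b.2, rfl⟩)
  · exact Ideal.span_mono (Set.image_mono hGK)

end Groebner

section LeadingForms

variable {a b : ℕ}

theorem X_mul_X_eq_monomial {σ : Type} (p q : σ) :
    (X p * X q : MvPolynomial σ ℤ) = monomial (pairExp p q) 1 := by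
  rw [X, X, monomial_mul, one_mul]
  rfl

theorem minors_matrixX {f : Poly a b} : f ∈ minors (matrixX a b) ↔ ∃ i j : Fin a, i < j ∧
    f = x i.castSucc * x j.succ - x j.castSucc * x i.succ := by
  simp [minors, matrixX, Matrix.det_fin_two]

theorem minors_matrixY {f : Poly a b} : f ∈ minors (matrixY a b) ↔ ∃ i j : Fin b, i < j ∧
    f = y i.castSucc * y j.succ - y j.castSucc * y i.succ := by
  simp [minors, matrixY, Matrix.det_fin_two]

theorem toSyn_zero_lt_pairExp (p q : Vars a b) :
    (revLex a b).toSyn 0 < (revLex a b).toSyn (pairExp p q) := by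
  rw [degRevLex_toSyn_lt_iff, degree_pairExp, map_zero]
  exact Or.inl two_pos

theorem degree_leadingCoeff_binomial {p q r s : Vars a b} (hpq : p ≤ q) (hrs : r ≤ s)
    (h : q < s ∨ (q = s ∧ p < r)) {f : Poly a b} (hf : f = X r * X s - X p * X q) :
    (revLex a b).degree f = pairExp p q ∧ (revLex a b).leadingCoeff f = -1 := by
  refine degree_leadingCoeff_of_lt (revLex a b) (g := monomial (pairExp r s) 1)
    isUnit_one.neg ?_ ?_ (toSyn_zero_lt_pairExp p q)
  · rw [hf, X_mul_X_eq_monomial, X_mul_X_eq_monomial, map_neg]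
    ring
  · intro ν hν
    rw [Finset.mem_singleton.1 (support_monomial_subset hν)]
    exact toSyn_pairExp_lt hpq hrs h

theorem degree_leadingCoeff_minorX {i j : Fin a} (h : i < j) :
    (revLex a b).degree (x i.castSucc * x j.succ - x j.castSucc * x i.succ) =
      pairExp (Sum.inlₗ i.succ) (Sum.inlₗ j.castSucc) ∧
    (revLex a b).leadingCoeff (x i.castSucc * x j.succ - x j.castSucc * x i.succ) = -1 := by
  refine degree_leadingCoeff_binomial (r := Sum.inlₗ i.castSucc) (s := Sum.inlₗ j.succ)
    ?_ ?_ (Or.inl ?_) (by rw [x, x, x, x, mul_comm (X (Sum.inlₗ j.castSucc))])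
  · exact Sum.Lex.inl_le_inl_iff.2 (Fin.le_def.2 h)
  · exact Sum.Lex.inl_le_inl_iff.2 (Fin.le_def.2 (Nat.le_succ_of_le (le_of_lt h)))
  · exact Sum.Lex.inl_lt_inl_iff.2 j.castSucc_lt_succ

theorem degree_leadingCoeff_minorY {i j : Fin b} (h : i < j) :
    (revLex a b).degree (y i.castSucc * y j.succ - y j.castSucc * y i.succ) =
      pairExp (Sum.inrₗ i.succ) (Sum.inrₗ j.castSucc) ∧
    (revLex a b).leadingCoeff (y i.castSucc * y j.succ - y j.castSucc * y i.succ) = -1 := by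
  refine degree_leadingCoeff_binomial (r := Sum.inrₗ i.castSucc) (s := Sum.inrₗ j.succ)
    ?_ ?_ (Or.inl ?_) (by rw [y, y, y, y, mul_comm (X (Sum.inrₗ j.castSucc))])
  · exact Sum.Lex.inr_le_inr_iff.2 (Fin.le_def.2 h)
  · exact Sum.Lex.inr_le_inr_iff.2 (Fin.le_def.2 (Nat.le_succ_of_le (le_of_lt h)))
  · exact Sum.Lex.inr_lt_inr_iff.2 j.castSucc_lt_succ

theorem degree_leadingCoeff_bilinearForm (i : Fin (a - 1)) (j : Fin (b - 1)) :
    (revLex a b).degree (bilinearForm a b i j) =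
      pairExp (Sum.inlₗ ⟨i + 2, by omega⟩) (Sum.inrₗ ⟨j, by omega⟩) ∧
    (revLex a b).leadingCoeff (bilinearForm a b i j) = 1 := by
  have hxy : ∀ (k : Fin (a + 1)) (l : Fin (b + 1)), (Sum.inlₗ k : Vars a b) ≤ Sum.inrₗ l :=
    fun k l => Sum.Lex.inl_le_inr k l
  refine degree_leadingCoeff_of_lt (revLex a b)
    (g := monomial (pairExp (Sum.inlₗ ⟨i + 1, by omega⟩) (Sum.inrₗ ⟨j + 1, by omega⟩)) (-2) +
      monomial (pairExp (Sum.inlₗ ⟨i, by omega⟩) (Sum.inrₗ ⟨j + 2, by omega⟩)) 1)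
    isUnit_one ?_ ?_ (toSyn_zero_lt_pairExp _ _)
  · have h2 : (monomial (pairExp (Sum.inlₗ ⟨i + 1, by omega⟩) (Sum.inrₗ ⟨j + 1, by omega⟩)) (-2) :
        Poly a b) = (-2) * (X (Sum.inlₗ ⟨i + 1, by omega⟩) * X (Sum.inrₗ ⟨j + 1, by omega⟩)) := by
      rw [X_mul_X_eq_monomial, show (-2 : Poly a b) = C (-2) from by simp, C_mul_monomial, mul_one]
    rw [h2, ← X_mul_X_eq_monomial, ← X_mul_X_eq_monomial, bilinearForm, x, x, x, y, y, y]
    ring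
  · intro ν hν
    rcases Finset.mem_union.1 (support_add hν) with hν | hν
    · rw [Finset.mem_singleton.1 (support_monomial_subset hν)]
      exact toSyn_pairExp_lt (hxy _ _) (hxy _ _) (Or.inl (Sum.Lex.inr_lt_inr_iff.2
        (Fin.lt_def.2 (Nat.lt_succ_self _))))
    · rw [Finset.mem_singleton.1 (support_monomial_subset hν)]
      exact toSyn_pairExp_lt (hxy _ _) (hxy _ _) (Or.inl (Sum.Lex.inr_lt_inr_iff.2
        (Fin.lt_def.2 (Nat.lt_add_of_pos_right two_pos))))

variable (a b) in
/-- The pairs of variables whose products are the leading monomials. -/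
def LeadPair (p q : Vars a b) : Prop :=
  (∃ k l : Fin (a + 1), 1 ≤ k.1 ∧ k ≤ l ∧ l.1 < a ∧ p = Sum.inlₗ k ∧ q = Sum.inlₗ l) ∨
  (∃ k l : Fin (b + 1), 1 ≤ k.1 ∧ k ≤ l ∧ l.1 < b ∧ p = Sum.inrₗ k ∧ q = Sum.inrₗ l) ∨
  (∃ (k : Fin (a + 1)) (l : Fin (b + 1)), 2 ≤ k.1 ∧ l.1 + 2 ≤ b ∧ p = Sum.inlₗ k ∧ q = Sum.inrₗ l)

theorem LeadPair.le {p q : Vars a b} (h : LeadPair a b p q) : p ≤ q := by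
  rcases h with ⟨k, l, -, h, -, rfl, rfl⟩ | ⟨k, l, -, h, -, rfl, rfl⟩ | ⟨k, l, -, -, rfl, rfl⟩
  · exact Sum.Lex.inl_le_inl_iff.2 h
  · exact Sum.Lex.inr_le_inr_iff.2 h
  · exact Sum.Lex.inl_le_inr k l

theorem mem_leadExps_iff {m : Vars a b →₀ ℕ} :
    m ∈ leadExps a b ↔ ∃ p q, LeadPair a b p q ∧ m = pairExp p q := by
  constructor
  · rintro ⟨f, (hf | hf) | ⟨i, j, rfl⟩, rfl⟩
    · obtain ⟨i, j, h, rfl⟩ := minors_matrixX.1 hf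
      exact ⟨_, _, Or.inl ⟨i.succ, j.castSucc, by simp, Fin.le_def.2 h, j.2, rfl, rfl⟩,
        (degree_leadingCoeff_minorX h).1⟩
    · obtain ⟨i, j, h, rfl⟩ := minors_matrixY.1 hf
      exact ⟨_, _, Or.inr (Or.inl ⟨i.succ, j.castSucc, by simp, Fin.le_def.2 h, j.2, rfl, rfl⟩),
        (degree_leadingCoeff_minorY h).1⟩
    · refine ⟨_, _, Or.inr (Or.inr ⟨_, _, ?_, ?_, rfl, rfl⟩),
        (degree_leadingCoeff_bilinearForm i j).1⟩
      · exact Nat.le_add_left 2 _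
      · have := j.2
        change j.1 + 2 ≤ b
        omega
  · rintro ⟨p, q, ⟨k, l, hk, hkl, hl, rfl, rfl⟩ | ⟨k, l, hk, hkl, hl, rfl, rfl⟩ |
      ⟨k, l, hk, hl, rfl, rfl⟩, rfl⟩
    · obtain ⟨k', rfl⟩ := Fin.exists_succ_eq.2 (by rintro rfl; simp at hk : k ≠ 0)
      have h : k' < ⟨l, hl⟩ := hkl
      exact ⟨_, Or.inl (Or.inl (minors_matrixX.2 ⟨k', ⟨l, hl⟩, h, rfl⟩)),
        (degree_leadingCoeff_minorX h).1⟩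
    · obtain ⟨k', rfl⟩ := Fin.exists_succ_eq.2 (by rintro rfl; simp at hk : k ≠ 0)
      have h : k' < ⟨l, hl⟩ := hkl
      exact ⟨_, Or.inl (Or.inr (minors_matrixY.2 ⟨k', ⟨l, hl⟩, h, rfl⟩)),
        (degree_leadingCoeff_minorY h).1⟩
    · refine ⟨_, Or.inr ⟨⟨k - 2, by omega⟩, ⟨l, by omega⟩, rfl⟩, ?_⟩
      rw [(degree_leadingCoeff_bilinearForm _ _).1]
      congr 2
      exact Fin.ext (Nat.sub_add_cancel hk)

theorem isUnit_leadingCoeff_carpetForms {f : Poly a b} (hf : f ∈ carpetForms a b) :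
    IsUnit ((revLex a b).leadingCoeff f) := by
  rcases hf with (hf | hf) | ⟨i, j, rfl⟩
  · obtain ⟨i, j, h, rfl⟩ := minors_matrixX.1 hf
    rw [(degree_leadingCoeff_minorX h).2]
    exact isUnit_one.neg
  · obtain ⟨i, j, h, rfl⟩ := minors_matrixY.1 hf
    rw [(degree_leadingCoeff_minorY h).2]
    exact isUnit_one.neg
  · rw [(degree_leadingCoeff_bilinearForm _ _).2]
    exact isUnit_one

theorem inl_succ_le_inl_castSucc {i j : Fin a} (h : i < j) :
    (Sum.inlₗ i.succ : Vars a b) ≤ Sum.inlₗ j.castSucc :=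
  Sum.Lex.inl_le_inl_iff.2 (Fin.le_def.2 h)

theorem inr_succ_le_inr_castSucc {i j : Fin b} (h : i < j) :
    (Sum.inrₗ i.succ : Vars a b) ≤ Sum.inrₗ j.castSucc :=
  Sum.Lex.inr_le_inr_iff.2 (Fin.le_def.2 h)

theorem inl_le_inr (i : Fin (a + 1)) (j : Fin (b + 1)) : (Sum.inlₗ i : Vars a b) ≤ Sum.inrₗ j :=
  Sum.Lex.inl_le_inr i j

theorem carpetForms_irredundant {f g : Poly a b} (hf : f ∈ carpetForms a b)
    (hg : g ∈ carpetForms a b) (h : (revLex a b).degree f ≤ (revLex a b).degree g) : f = g := by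
  rcases hf with (hf | hf) | ⟨i, j, rfl⟩
  · obtain ⟨i, j, hij, rfl⟩ := minors_matrixX.1 hf
    rw [(degree_leadingCoeff_minorX hij).1] at h
    rcases hg with (hg | hg) | ⟨k, l, rfl⟩
    · obtain ⟨k, l, hkl, rfl⟩ := minors_matrixX.1 hg
      rw [(degree_leadingCoeff_minorX hkl).1] at h
      obtain ⟨h₁, h₂⟩ := pairExp_inj (inl_succ_le_inl_castSucc hij)
        (inl_succ_le_inl_castSucc hkl) (pairExp_eq_of_le h)
      rw [Fin.succ_injective _ (Sum.inl_injective h₁),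
        Fin.castSucc_injective _ (Sum.inl_injective h₂)]
    · obtain ⟨k, l, hkl, rfl⟩ := minors_matrixY.1 hg
      rw [(degree_leadingCoeff_minorY hkl).1] at h
      exact absurd (pairExp_inj (inl_succ_le_inl_castSucc hij)
        (inr_succ_le_inr_castSucc hkl) (pairExp_eq_of_le h)).1 Sum.inl_ne_inr
    · rw [(degree_leadingCoeff_bilinearForm _ _).1] at h
      exact absurd (pairExp_inj (inl_succ_le_inl_castSucc hij)
        (inl_le_inr _ _) (pairExp_eq_of_le h)).2 Sum.inl_ne_inr
  · obtain ⟨i, j, hij, rfl⟩ := minors_matrixY.1 hf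
    rw [(degree_leadingCoeff_minorY hij).1] at h
    rcases hg with (hg | hg) | ⟨k, l, rfl⟩
    · obtain ⟨k, l, hkl, rfl⟩ := minors_matrixX.1 hg
      rw [(degree_leadingCoeff_minorX hkl).1] at h
      exact absurd (pairExp_inj (inr_succ_le_inr_castSucc hij)
        (inl_succ_le_inl_castSucc hkl) (pairExp_eq_of_le h)).1 Sum.inr_ne_inl
    · obtain ⟨k, l, hkl, rfl⟩ := minors_matrixY.1 hg
      rw [(degree_leadingCoeff_minorY hkl).1] at h
      obtain ⟨h₁, h₂⟩ := pairExp_inj (inr_succ_le_inr_castSucc hij)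
        (inr_succ_le_inr_castSucc hkl) (pairExp_eq_of_le h)
      rw [Fin.succ_injective _ (Sum.inr_injective h₁),
        Fin.castSucc_injective _ (Sum.inr_injective h₂)]
    · rw [(degree_leadingCoeff_bilinearForm _ _).1] at h
      exact absurd (pairExp_inj (inr_succ_le_inr_castSucc hij)
        (inl_le_inr _ _) (pairExp_eq_of_le h)).1 Sum.inr_ne_inl
  · rw [(degree_leadingCoeff_bilinearForm _ _).1] at h
    rcases hg with (hg | hg) | ⟨k, l, rfl⟩
    · obtain ⟨k, l, hkl, rfl⟩ := minors_matrixX.1 hg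
      rw [(degree_leadingCoeff_minorX hkl).1] at h
      exact absurd (pairExp_inj (inl_le_inr _ _)
        (inl_succ_le_inl_castSucc hkl) (pairExp_eq_of_le h)).2 Sum.inr_ne_inl
    · obtain ⟨k, l, hkl, rfl⟩ := minors_matrixY.1 hg
      rw [(degree_leadingCoeff_minorY hkl).1] at h
      exact absurd (pairExp_inj (inl_le_inr _ _)
        (inr_succ_le_inr_castSucc hkl) (pairExp_eq_of_le h)).1 Sum.inl_ne_inr
    · rw [(degree_leadingCoeff_bilinearForm _ _).1] at h
      obtain ⟨h₁, h₂⟩ := pairExp_inj (inl_le_inr _ _) (inl_le_inr _ _) (pairExp_eq_of_le h)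
      have h₃ : i.1 + 2 = k.1 + 2 := congrArg Fin.val (Sum.inl_injective h₁)
      have h₄ := congrArg Fin.val (Sum.inr.inj h₂)
      rw [Fin.ext (Nat.add_right_cancel h₃), Fin.ext (show j.1 = l.1 from h₄)]

end LeadingForms

section StandardMonomials

theorem pairExp_le_of_ne {σ : Type} {p q : σ} (h : p ≠ q) {α : σ →₀ ℕ} (hp : α p ≠ 0)
    (hq : α q ≠ 0) : pairExp p q ≤ α := by
  classical
  intro i
  rw [pairExp, Finsupp.add_apply, Finsupp.single_apply, Finsupp.single_apply]
  split_ifs with h₁ h₂ h₂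
  · exact absurd (h₁.trans h₂.symm) h
  · subst h₁; omega
  · subst h₂; omega
  · omega

theorem pairExp_self_le {σ : Type} {p : σ} {α : σ →₀ ℕ} (hp : 2 ≤ α p) : pairExp p p ≤ α := by
  classical
  intro i
  rw [pairExp, Finsupp.add_apply, Finsupp.single_apply]
  split_ifs with h₁
  · subst h₁; omega
  · omega

/-- Exponents of a monomial in `z_0, …, z_n` that is not divisible by a product of two of the
inner variables. -/
theorem exists_normal_form {n : ℕ} (hn : 2 ≤ n) (g : Fin (n + 1) → ℕ)
    (h : ∀ k l : Fin (n + 1), 1 ≤ k.1 → k < l → l.1 < n → g k = 0 ∨ g l = 0)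
    (h' : ∀ k : Fin (n + 1), 1 ≤ k.1 → k.1 < n → g k ≤ 1) :
    ∃ r : Fin (n + 1), r.1 < n ∧
      (∀ k : Fin (n + 1), 1 ≤ k.1 → k.1 < n → g k = if k = r then 1 else 0) ∧
      ∑ k, g k = g 0 + g (Fin.last n) + (if r.1 = 0 then 0 else 1) ∧
      ∑ k : Fin (n + 1), k.1 * g k = n * g (Fin.last n) + r := by
  have key : ∃ r : Fin (n + 1), r.1 < n ∧
      ∀ k : Fin (n + 1), 1 ≤ k.1 → k.1 < n → g k = if k = r then 1 else 0 := by
    by_cases hr : ∃ r : Fin (n + 1), 1 ≤ r.1 ∧ r.1 < n ∧ g r ≠ 0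
    · obtain ⟨r, hr₁, hr₂, hr₃⟩ := hr
      refine ⟨r, hr₂, fun k hk₁ hk₂ => ?_⟩
      split_ifs with hkr
      · subst hkr
        have := h' k hk₁ hk₂
        omega
      · rcases lt_or_gt_of_ne hkr with hlt | hlt
        · exact (h k r hk₁ hlt hr₂).resolve_right hr₃
        · exact (h r k hr₁ hlt hk₂).resolve_left hr₃
    · push Not at hr
      refine ⟨0, by simp; omega, fun k hk₁ hk₂ => ?_⟩
      rw [if_neg (by rintro rfl; simp at hk₁ : k ≠ 0)]
      exact hr k hk₁ hk₂
  obtain ⟨r, hr, hk⟩ := key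
  have hg : ∀ k, g k = (if k = 0 then g 0 else 0) + (if k = Fin.last n then g (Fin.last n) else 0) +
      (if k = r then if r.1 = 0 then 0 else 1 else 0) := by
    intro k
    rcases eq_or_ne k 0 with rfl | h0
    · have h₁ : (0 : Fin (n + 1)) ≠ Fin.last n := fun h => by
        have := congrArg Fin.val h
        simp at this
        omega
      rw [if_pos rfl, if_neg h₁]
      split_ifs with h₂ h₃
      · rfl
      · exact absurd (congrArg Fin.val h₂.symm) h₃
      · rfl
    · rcases eq_or_ne k (Fin.last n) with rfl | h1
      · have h₁ : Fin.last n ≠ r := fun h => by rw [← h] at hr; simp at hr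
        rw [if_neg h0, if_pos rfl, if_neg h₁, zero_add, add_zero]
      · have h₁ : 1 ≤ k.1 := Nat.one_le_iff_ne_zero.2 fun h => h0 (Fin.ext h)
        have h₂ : k.1 < n := lt_of_le_of_ne (Nat.lt_succ_iff.1 k.2) fun h => h1 (Fin.ext h)
        rw [hk k h₁ h₂, if_neg h0, if_neg h1, zero_add, zero_add]
        split_ifs with h₃
        · subst h₃; omega
        · rfl
        · rfl
  refine ⟨r, hr, hk, ?_, ?_⟩
  · rw [Finset.sum_congr rfl fun k _ => hg k]
    simp [Finset.sum_add_distrib]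
  · rw [Finset.sum_congr rfl fun k _ => congrArg (k.1 * ·) (hg k)]
    simp only [mul_add, Finset.sum_add_distrib, mul_ite, mul_zero, Finset.sum_ite_eq',
      Finset.mem_univ, if_true]
    simp
    intro h
    rw [h]
    rfl

theorem normal_form_unique {n : ℕ} (hn : 2 ≤ n) {g g' : Fin (n + 1) → ℕ}
    (h : ∀ k l : Fin (n + 1), 1 ≤ k.1 → k < l → l.1 < n → g k = 0 ∨ g l = 0)
    (h' : ∀ k : Fin (n + 1), 1 ≤ k.1 → k.1 < n → g k ≤ 1)
    (k : ∀ k l : Fin (n + 1), 1 ≤ k.1 → k < l → l.1 < n → g' k = 0 ∨ g' l = 0)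
    (k' : ∀ k : Fin (n + 1), 1 ≤ k.1 → k.1 < n → g' k ≤ 1)
    (hsum : ∑ k, g k = ∑ k, g' k) (hw : ∑ k : Fin (n + 1), k.1 * g k = ∑ k, k.1 * g' k) :
    g = g' := by
  obtain ⟨r, hr, hg, hs, hw₁⟩ := exists_normal_form hn g h h'
  obtain ⟨r', hr', hg', hs', hw₁'⟩ := exists_normal_form hn g' k k'
  rw [hw₁, hw₁'] at hw
  have h₁ : g (Fin.last n) = g' (Fin.last n) := by
    have := congrArg (· / n) hw
    simpa [Nat.mul_add_div (by omega : 0 < n), Nat.div_eq_of_lt hr, Nat.div_eq_of_lt hr'] using this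
  have h₂ : r = r' := Fin.ext (by rw [h₁] at hw; omega)
  subst h₂
  have h₃ : g 0 = g' 0 := by omega
  funext i
  rcases eq_or_ne i 0 with rfl | h0
  · exact h₃
  rcases eq_or_ne i (Fin.last n) with rfl | h1
  · exact h₁
  have h₄ : 1 ≤ i.1 := Nat.one_le_iff_ne_zero.2 fun h => h0 (Fin.ext h)
  have h₅ : i.1 < n := lt_of_le_of_ne (Nat.lt_succ_iff.1 i.2) fun h => h1 (Fin.ext h)
  rw [hg i h₄ h₅, hg' i h₄ h₅]

variable {a b : ℕ}

/-- The degree in the variables `x_i`. -/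
def degX (α : Vars a b →₀ ℕ) : ℕ := ∑ i : Fin (a + 1), α (Sum.inlₗ i)

/-- The degree in the variables `y_j`. -/
def degY (α : Vars a b →₀ ℕ) : ℕ := ∑ j : Fin (b + 1), α (Sum.inrₗ j)

/-- The degree in the variables `x_i`, where `x_i` has weight `i`. -/
def weightX (α : Vars a b →₀ ℕ) : ℕ := ∑ i : Fin (a + 1), i.1 * α (Sum.inlₗ i)

/-- The degree in the variables `y_j`, where `y_j` has weight `j`. -/
def weightY (α : Vars a b →₀ ℕ) : ℕ := ∑ j : Fin (b + 1), j.1 * α (Sum.inrₗ j)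

/-- The monomials that are not divisible by a leading monomial of the forms. -/
def IsStandard (α : Vars a b →₀ ℕ) : Prop := ∀ m ∈ leadExps a b, ¬ m ≤ α

theorem IsStandard.not_le {α : Vars a b →₀ ℕ} (h : IsStandard α) {p q : Vars a b}
    (hpq : LeadPair a b p q) : ¬ pairExp p q ≤ α :=
  h _ (mem_leadExps_iff.2 ⟨p, q, hpq, rfl⟩)

theorem IsStandard.eq_zero_or {α : Vars a b →₀ ℕ} (h : IsStandard α) {p q : Vars a b}
    (hpq : LeadPair a b p q) (hne : p ≠ q) : α p = 0 ∨ α q = 0 := by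
  by_contra! h'
  exact h.not_le hpq (pairExp_le_of_ne hne h'.1 h'.2)

theorem IsStandard.le_one {α : Vars a b →₀ ℕ} (h : IsStandard α) {p : Vars a b}
    (hp : LeadPair a b p p) : α p ≤ 1 := by
  by_contra! h'
  exact h.not_le hp (pairExp_self_le h')

theorem IsStandard.x_zero_or {α : Vars a b →₀ ℕ} (h : IsStandard α) (k l : Fin (a + 1))
    (hk : 1 ≤ k.1) (hkl : k < l) (hl : l.1 < a) :
    α (Sum.inlₗ k) = 0 ∨ α (Sum.inlₗ l) = 0 :=
  h.eq_zero_or (Or.inl ⟨k, l, hk, hkl.le, hl, rfl, rfl⟩) fun h => hkl.ne (Sum.inl_injective h)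

theorem IsStandard.x_le_one {α : Vars a b →₀ ℕ} (h : IsStandard α) (k : Fin (a + 1))
    (hk : 1 ≤ k.1) (hl : k.1 < a) : α (Sum.inlₗ k) ≤ 1 :=
  h.le_one (Or.inl ⟨k, k, hk, le_rfl, hl, rfl, rfl⟩)

theorem IsStandard.y_zero_or {α : Vars a b →₀ ℕ} (h : IsStandard α) (k l : Fin (b + 1))
    (hk : 1 ≤ k.1) (hkl : k < l) (hl : l.1 < b) :
    α (Sum.inrₗ k) = 0 ∨ α (Sum.inrₗ l) = 0 :=
  h.eq_zero_or (Or.inr (Or.inl ⟨k, l, hk, hkl.le, hl, rfl, rfl⟩)) fun h =>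
    hkl.ne (Sum.inr_injective h)

theorem IsStandard.y_le_one {α : Vars a b →₀ ℕ} (h : IsStandard α) (k : Fin (b + 1))
    (hk : 1 ≤ k.1) (hl : k.1 < b) : α (Sum.inrₗ k) ≤ 1 :=
  h.le_one (Or.inr (Or.inl ⟨k, k, hk, le_rfl, hl, rfl, rfl⟩))

theorem IsStandard.x_y_zero_or {α : Vars a b →₀ ℕ} (h : IsStandard α) (k : Fin (a + 1))
    (l : Fin (b + 1)) (hk : 2 ≤ k.1) (hl : l.1 + 2 ≤ b) :
    α (Sum.inlₗ k) = 0 ∨ α (Sum.inrₗ l) = 0 :=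
  h.eq_zero_or (Or.inr (Or.inr ⟨k, l, hk, hl, rfl, rfl⟩)) Sum.inl_ne_inr

theorem IsStandard.ext (ha : 2 ≤ a) (hb : 2 ≤ b) {α β : Vars a b →₀ ℕ} (hα : IsStandard α)
    (hβ : IsStandard β) (h₁ : degX α = degX β) (h₂ : degY α = degY β)
    (h₃ : weightX α = weightX β) (h₄ : weightY α = weightY β) : α = β := by
  have hx := normal_form_unique ha (g := fun i => α (Sum.inlₗ i)) (g' := fun i => β (Sum.inlₗ i))
    hα.x_zero_or hα.x_le_one hβ.x_zero_or hβ.x_le_one h₁ h₃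
  have hy := normal_form_unique hb (g := fun i => α (Sum.inrₗ i)) (g' := fun i => β (Sum.inrₗ i))
    hα.y_zero_or hα.y_le_one hβ.y_zero_or hβ.y_le_one h₂ h₄
  have h : ∀ p : Fin (a + 1) ⊕ Fin (b + 1), α (toLex p) = β (toLex p) := by
    rintro (i | j)
    · exact congrFun hx i
    · exact congrFun hy j
  exact Finsupp.ext fun p => h (ofLex p)

theorem weightY_le (α : Vars a b →₀ ℕ) : weightY α ≤ b * degY α := by
  rw [weightY, degY, Finset.mul_sum]
  exact Finset.sum_le_sum fun j _ => Nat.mul_le_mul_right _ (Nat.lt_succ_iff.1 j.2)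

theorem IsStandard.weight_bound (ha : 2 ≤ a) (hb : 2 ≤ b) {α : Vars a b →₀ ℕ}
    (h : IsStandard α) : weightX α ≤ 1 ∨ b * degY α ≤ weightY α + 1 := by
  by_cases hx : ∃ k : Fin (a + 1), 2 ≤ k.1 ∧ α (Sum.inlₗ k) ≠ 0
  · obtain ⟨k, hk, hk'⟩ := hx
    have hy : ∀ l : Fin (b + 1), l.1 + 2 ≤ b → α (Sum.inrₗ l) = 0 := fun l hl =>
      (h.x_y_zero_or k l hk hl).resolve_left hk'
    obtain ⟨r, hr, hg, hs, hw⟩ := exists_normal_form hb (fun j => α (Sum.inrₗ j))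
      h.y_zero_or h.y_le_one
    refine Or.inr ?_
    have h0 : α (Sum.inrₗ (0 : Fin (b + 1))) = 0 := hy 0 (by simpa using hb)
    rw [weightY, degY, hs, hw, h0]
    split_ifs with hr0
    · rw [hr0, zero_add, add_zero]
      omega
    · have : ¬ r.1 + 2 ≤ b := fun hrb => by
        have h₁ := hg r (by omega) hr
        rw [if_pos rfl] at h₁
        have h₂ := hy r hrb
        omega
      rw [zero_add, mul_add]
      omega
  · push Not at hx
    obtain ⟨r, hr, hg, hs, hw⟩ := exists_normal_form ha (fun j => α (Sum.inlₗ j))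
      h.x_zero_or h.x_le_one
    refine Or.inl ?_
    rw [weightX, hw, hx (Fin.last a) (by simpa using ha), mul_zero, zero_add]
    by_contra! hr1
    have h₁ := hg r (by omega) hr
    rw [if_pos rfl] at h₁
    have h₂ := hx r hr1
    omega

end StandardMonomials

noncomputable section Parametrization

variable (a b : ℕ)

/-- The parametrization `x_i ↦ u t^i`, `y_j ↦ v (t + t ε)^j` of the carpet, where `ε ^ 2 = 0`. -/
def carpetParam : Poly a b →ₐ[ℤ] DualNumber (MvPolynomial (Fin 3) ℤ) :=
  aeval fun p : Vars a b => Sum.elim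
    (fun i : Fin (a + 1) => TrivSqZeroExt.inl (X 0) * TrivSqZeroExt.inl (X 2) ^ i.1)
    (fun j : Fin (b + 1) => TrivSqZeroExt.inl (X 1) *
      (TrivSqZeroExt.inl (X 2) * (1 + DualNumber.eps)) ^ j.1) (ofLex p)

variable {a b}

theorem carpetParam_x (i : Fin (a + 1)) : carpetParam a b (x i) =
    TrivSqZeroExt.inl (X 0) * TrivSqZeroExt.inl (X 2) ^ i.1 := by
  rw [carpetParam, x, aeval_X]
  rfl

theorem carpetParam_y (j : Fin (b + 1)) : carpetParam a b (y j) =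
    TrivSqZeroExt.inl (X 1) * (TrivSqZeroExt.inl (X 2) * (1 + DualNumber.eps)) ^ j.1 := by
  rw [carpetParam, y, aeval_X]
  rfl

theorem carpetParam_eq_zero {f : Poly a b} (hf : f ∈ carpetForms a b) : carpetParam a b f = 0 := by
  rcases hf with (hf | hf) | ⟨i, j, rfl⟩
  · obtain ⟨i, j, h, rfl⟩ := minors_matrixX.1 hf
    rw [map_sub, map_mul, map_mul, carpetParam_x, carpetParam_x, carpetParam_x, carpetParam_x,
      Fin.val_succ, Fin.val_succ, Fin.val_castSucc, Fin.val_castSucc]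
    ring
  · obtain ⟨i, j, h, rfl⟩ := minors_matrixY.1 hf
    rw [map_sub, map_mul, map_mul, carpetParam_y, carpetParam_y, carpetParam_y, carpetParam_y,
      Fin.val_succ, Fin.val_succ, Fin.val_castSucc, Fin.val_castSucc]
    ring
  · have h : (DualNumber.eps : DualNumber (MvPolynomial (Fin 3) ℤ)) * DualNumber.eps = 0 :=
      DualNumber.eps_mul_eps
    rw [bilinearForm, map_add, map_sub, map_mul, map_mul, map_mul, map_mul, map_ofNat,
      carpetParam_x, carpetParam_x, carpetParam_x, carpetParam_y, carpetParam_y, carpetParam_y]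
    set u : DualNumber (MvPolynomial (Fin 3) ℤ) := TrivSqZeroExt.inl (X 0)
    set v : DualNumber (MvPolynomial (Fin 3) ℤ) := TrivSqZeroExt.inl (X 1)
    set t : DualNumber (MvPolynomial (Fin 3) ℤ) := TrivSqZeroExt.inl (X 2)
    set e : DualNumber (MvPolynomial (Fin 3) ℤ) := DualNumber.eps
    linear_combination (u * v * t ^ (i : ℕ) * t ^ 2 * (t * (1 + e)) ^ (j : ℕ)) * h

theorem one_add_eps_pow (n : ℕ) :
    (1 + DualNumber.eps : DualNumber (MvPolynomial (Fin 3) ℤ)) ^ n =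
    1 + (n : DualNumber (MvPolynomial (Fin 3) ℤ)) * DualNumber.eps := by
  have h : (DualNumber.eps : DualNumber (MvPolynomial (Fin 3) ℤ)) * DualNumber.eps = 0 :=
    DualNumber.eps_mul_eps
  induction n with
  | zero => simp
  | succ n ih =>
    rw [pow_succ, ih]
    push_cast
    linear_combination (n : DualNumber (MvPolynomial (Fin 3) ℤ)) * h

/-- The exponent vector of the image of a monomial. -/
def paramExp (α : Vars a b →₀ ℕ) : Fin 3 →₀ ℕ :=
  Finsupp.single 0 (degX α) + Finsupp.single 1 (degY α) +
    Finsupp.single 2 (weightX α + weightY α)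

theorem carpetParam_monomial (α : Vars a b →₀ ℕ) (c : ℤ) :
    carpetParam a b (monomial α c) = TrivSqZeroExt.inl (monomial (paramExp α) c) *
      (1 + (weightY α : DualNumber (MvPolynomial (Fin 3) ℤ)) * DualNumber.eps) := by
  rw [carpetParam, aeval_monomial, Finsupp.prod_fintype _ _ fun _ => pow_zero _]
  have h : ∀ f : Vars a b → DualNumber (MvPolynomial (Fin 3) ℤ), ∏ p, f p =
      (∏ i : Fin (a + 1), f (Sum.inlₗ i)) * ∏ j : Fin (b + 1), f (Sum.inrₗ j) := fun f =>
    Fintype.prod_sum_type (fun p : Fin (a + 1) ⊕ Fin (b + 1) => f (toLex p))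
  rw [h]
  simp only [ofLex_toLex, Sum.elim_inl, Sum.elim_inr, mul_pow, ← pow_mul, Finset.prod_mul_distrib,
    Finset.prod_pow_eq_pow_sum]
  have hc : algebraMap ℤ (DualNumber (MvPolynomial (Fin 3) ℤ)) c =
      TrivSqZeroExt.inl (C c : MvPolynomial (Fin 3) ℤ) := rfl
  rw [paramExp, monomial_add_single, monomial_add_single, ← C_mul_X_pow_eq_monomial,
    hc, ← one_add_eps_pow, degX, degY, weightX, weightY]
  simp only [TrivSqZeroExt.inl_mul, TrivSqZeroExt.inl_pow, pow_add]
  ring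

theorem coeff_fst_carpetParam (f : Poly a b) (N : Fin 3 →₀ ℕ) :
    coeff N (carpetParam a b f).fst = ∑ α ∈ f.support with paramExp α = N, coeff α f := by
  conv_lhs => rw [← support_sum_monomial_coeff f]
  rw [map_sum, TrivSqZeroExt.fst_sum, coeff_sum, Finset.sum_filter]
  refine Finset.sum_congr rfl fun α _ => ?_
  rw [carpetParam_monomial]
  simp [coeff_monomial]

theorem coeff_snd_carpetParam (f : Poly a b) (N : Fin 3 →₀ ℕ) :
    coeff N (carpetParam a b f).snd =
      ∑ α ∈ f.support with paramExp α = N, coeff α f * weightY α := by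
  conv_lhs => rw [← support_sum_monomial_coeff f]
  rw [map_sum, TrivSqZeroExt.snd_sum, coeff_sum, Finset.sum_filter]
  refine Finset.sum_congr rfl fun α _ => ?_
  have h : (carpetParam a b (monomial α (coeff α f))).snd =
      monomial (paramExp α) (coeff α f * weightY α) := by
    have hn : ((weightY α : ℕ) : MvPolynomial (Fin 3) ℤ) = C (weightY α : ℤ) := by simp
    rw [mul_comm (coeff α f), ← C_mul_monomial, ← hn, carpetParam_monomial]
    simp [mul_comm]
  rw [h, coeff_monomial]

theorem paramExp_eq_iff {α β : Vars a b →₀ ℕ} : paramExp α = paramExp β ↔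
    degX α = degX β ∧ degY α = degY β ∧ weightX α + weightY α = weightX β + weightY β := by
  constructor
  · intro h
    have h₀ := DFunLike.congr_fun h 0
    have h₁ := DFunLike.congr_fun h 1
    have h₂ := DFunLike.congr_fun h 2
    simp [paramExp] at h₀ h₁ h₂
    exact ⟨h₀, h₁, h₂⟩
  · rintro ⟨h₀, h₁, h₂⟩
    rw [paramExp, paramExp, h₀, h₁, h₂]

/-- The standard monomials are linearly independent modulo the kernel of the parametrization. -/
theorem eq_zero_of_carpetParam_eq_zero (ha : 2 ≤ a) (hb : 2 ≤ b) {f : Poly a b}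
    (hf : carpetParam a b f = 0) (hstd : ∀ α ∈ f.support, IsStandard α) : f = 0 := by
  classical
  by_contra hne
  obtain ⟨α, hα⟩ := Finset.nonempty_iff_ne_empty.2 (fun h => hne (support_eq_empty.1 h))
  set F := f.support.filter fun β => paramExp β = paramExp α with hF
  have hαF : α ∈ F := Finset.mem_filter.2 ⟨hα, rfl⟩
  have h₀ : ∑ β ∈ F, coeff β f = 0 := by
    rw [hF, ← coeff_fst_carpetParam, hf, TrivSqZeroExt.fst_zero, coeff_zero]
  have h₁ : ∑ β ∈ F, coeff β f * weightY β = 0 := by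
    rw [hF, ← coeff_snd_carpetParam, hf, TrivSqZeroExt.snd_zero, coeff_zero]
  have hinj : ∀ β ∈ F, ∀ γ ∈ F, weightY β = weightY γ → β = γ := by
    intro β hβ γ hγ h
    obtain ⟨hβ₁, hβ₂⟩ := Finset.mem_filter.1 hβ
    obtain ⟨hγ₁, hγ₂⟩ := Finset.mem_filter.1 hγ
    obtain ⟨e₀, e₁, e₂⟩ := paramExp_eq_iff.1 (hβ₂.trans hγ₂.symm)
    exact (hstd β hβ₁).ext ha hb (hstd γ hγ₁) e₀ e₁ (by omega) h
  have hclose : ∀ β ∈ F, ∀ γ ∈ F, weightY β ≤ weightY γ + 1 := by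
    intro β hβ γ hγ
    obtain ⟨hβ₁, hβ₂⟩ := Finset.mem_filter.1 hβ
    obtain ⟨hγ₁, hγ₂⟩ := Finset.mem_filter.1 hγ
    obtain ⟨-, e₁, e₂⟩ := paramExp_eq_iff.1 (hβ₂.trans hγ₂.symm)
    have b₁ := weightY_le β
    rw [e₁] at b₁
    rcases (hstd γ hγ₁).weight_bound ha hb with h | h <;> omega
  refine mem_support_iff.1 hα ?_
  by_cases hβ : ∃ β ∈ F, β ≠ α
  · obtain ⟨β, hβF, hβα⟩ := hβ
    have h₂ : ∑ γ ∈ F, coeff γ f * ((weightY γ : ℤ) - weightY β) = 0 := by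
      rw [Finset.sum_congr rfl fun γ _ => mul_sub (coeff γ f) _ _, Finset.sum_sub_distrib,
        ← Finset.sum_mul, h₀, h₁, zero_mul, sub_zero]
    have hne' : weightY α ≠ weightY β := fun h => hβα (hinj α hαF β hβF h).symm
    rw [Finset.sum_eq_single_of_mem α hαF] at h₂
    · refine (mul_eq_zero.1 h₂).resolve_right ?_
      rw [sub_eq_zero]
      exact_mod_cast hne'
    · intro γ hγ hγα
      have hne₁ : weightY γ ≠ weightY α := fun h => hγα (hinj γ hγ α hαF h)
      have c₁ := hclose α hαF β hβF
      have c₂ := hclose β hβF α hαF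
      have c₃ := hclose γ hγ β hβF
      have c₄ := hclose β hβF γ hγ
      have c₅ := hclose γ hγ α hαF
      have c₆ := hclose α hαF γ hγ
      rw [show weightY γ = weightY β by omega, sub_self, mul_zero]
  · push Not at hβ
    rwa [Finset.sum_eq_single_of_mem α hαF fun β hβF h => absurd (hβ β hβF) h] at h₀

/-- The kernel of the parametrization. -/
theorem ker_carpetParam (ha : 2 ≤ a) (hb : 2 ≤ b) :
    RingHom.ker (carpetParam a b) = Ideal.span (carpetForms a b) ∧
      initialIdeal (revLex a b) (RingHom.ker (carpetParam a b)) =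
        Ideal.span ((revLex a b).leadingTerm '' carpetForms a b) := by
  refine groebner_of_standard_independent (revLex a b) (fun f hf => carpetParam_eq_zero hf)
    (fun f hf => isUnit_leadingCoeff_carpetForms hf) fun f hf hstd => ?_
  refine eq_zero_of_carpetParam_eq_zero ha hb hf fun α hα => ?_
  rintro _ ⟨g, hg, rfl⟩
  exact hstd α hα g hg

theorem eq_zero_of_mul_carpetParam_y_pow (j : Fin (b + 1)) (n : ℕ)
    {z : DualNumber (MvPolynomial (Fin 3) ℤ)} (h : z * carpetParam a b (y j) ^ n = 0) : z = 0 := by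
  have hfst : (carpetParam a b (y j) ^ n).fst ≠ 0 := by
    rw [carpetParam_y]
    simp
  have h₁ : z.fst = 0 := by
    have := congrArg TrivSqZeroExt.fst h
    rw [TrivSqZeroExt.fst_mul, TrivSqZeroExt.fst_zero] at this
    exact (mul_eq_zero.1 this).resolve_right hfst
  have h₂ : z.snd = 0 := by
    have := congrArg TrivSqZeroExt.snd h
    rw [DualNumber.snd_mul, TrivSqZeroExt.snd_zero, h₁, zero_mul, zero_add] at this
    exact (mul_eq_zero.1 this).resolve_right hfst
  exact TrivSqZeroExt.ext h₁ h₂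

theorem carpetIdeal_eq_span (ha : 2 ≤ a) (hb : 2 ≤ b) :
    carpetIdeal a b = Ideal.span (carpetForms a b) := by
  rw [carpetIdeal, saturation]
  refine le_antisymm (iSup_le fun n f hf => ?_) (le_iSup_of_le 0 fun f hf => ?_)
  · rw [← (ker_carpetParam ha hb).1] at hf ⊢
    have h := Submodule.mem_colon.1 hf (y 0 ^ n)
      (Ideal.pow_mem_pow (Ideal.subset_span (Set.mem_range_self (Sum.inrₗ 0))) n)
    rw [smul_eq_mul, RingHom.mem_ker, map_mul, map_pow] at h
    exact eq_zero_of_mul_carpetParam_y_pow 0 n h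
  · exact Submodule.mem_colon.2 fun s _ => Ideal.mul_mem_right s _ hf

theorem isNormalizedGroebnerBasis_carpetForms (ha : 2 ≤ a) (hb : 2 ≤ b) :
    IsNormalizedGroebnerBasis (revLex a b) (carpetIdeal a b) (carpetForms a b) := by
  rw [carpetIdeal_eq_span ha hb]
  refine ⟨Ideal.subset_span, fun f => isUnit_leadingCoeff_carpetForms,
    fun f hf g hg => carpetForms_irredundant hf hg, ?_⟩
  rw [← (ker_carpetParam ha hb).1]
  exact (ker_carpetParam ha hb).2

theorem span_leadingTerm_eq {σ R : Type} [CommRing R] (ord : MonomialOrder σ)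
    {G : Set (MvPolynomial σ R)} (hG : ∀ f ∈ G, IsUnit (ord.leadingCoeff f)) :
    Ideal.span (ord.leadingTerm '' G) =
      Ideal.span ((fun m => monomial m (1 : R)) '' (ord.degree '' G)) := by
  refine le_antisymm (Ideal.span_le.2 ?_) (Ideal.span_le.2 ?_)
  · rintro _ ⟨f, hf, rfl⟩
    have h : ord.leadingTerm f = C (ord.leadingCoeff f) * monomial (ord.degree f) 1 := by
      rw [C_mul_monomial, mul_one]
      rfl
    rw [h]
    exact Ideal.mul_mem_left _ _ (Ideal.subset_span ⟨_, ⟨f, hf, rfl⟩, rfl⟩)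
  · rintro _ ⟨_, ⟨f, hf, rfl⟩, rfl⟩
    have h : monomial (ord.degree f) (1 : R) =
        C (((hG f hf).unit⁻¹ : Rˣ) : R) * ord.leadingTerm f := by
      rw [MonomialOrder.leadingTerm, C_mul_monomial]
      simp
    simp only [h]
    exact Ideal.mul_mem_left _ _ (Ideal.subset_span ⟨f, hf, rfl⟩)

end Parametrization

section Koszul

variable {σ : Type} {ord : MonomialOrder σ} {S : Set (σ →₀ ℕ)}

theorem schreyerGens_cons_subset {w : List (σ →₀ ℕ)} {m : σ →₀ ℕ} {T : Set (σ →₀ ℕ)}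
    (h : ∀ t ∈ schreyerGens ord S w, Precedes ord t m → ∃ g ∈ T, g ≤ t - m)
    (hT : ∀ g ∈ T, ∃ t ∈ schreyerGens ord S w, Precedes ord t m ∧ t ≤ g + m) :
    schreyerGens ord S (m :: w) ⊆ T := by
  rintro δ ⟨⟨t, ht, htm, hle⟩, hmin⟩
  obtain ⟨g, hg, hgt⟩ := h t ht htm
  have hgδ : g ≤ δ := hgt.trans (tsub_le_iff_right.2 hle)
  rwa [le_antisymm (hmin (hT g hg) hgδ) hgδ]

theorem subset_schreyerGens_cons {w : List (σ →₀ ℕ)} {m : σ →₀ ℕ} {T : Set (σ →₀ ℕ)}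
    (h : schreyerGens ord S (m :: w) ⊆ T)
    (hT : ∀ g ∈ T, ∃ t ∈ schreyerGens ord S w, Precedes ord t m ∧ t ≤ g + m)
    (hanti : ∀ g ∈ T, ∀ g' ∈ T, g ≤ g' → g = g') : T ⊆ schreyerGens ord S (m :: w) := by
  intro g hg
  obtain ⟨δ, hδg, hδ⟩ := exists_minimal_le_of_wellFoundedLT
    (fun δ => ∃ t ∈ schreyerGens ord S w, Precedes ord t m ∧ t ≤ δ + m) g (hT g hg)
  have hδ' : δ ∈ schreyerGens ord S (m :: w) := hδ
  rwa [← hanti δ (h hδ') g hg hδg]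

/-- Distinct elements involve different variables. -/
def PairwiseCoprime (T : Set (σ →₀ ℕ)) : Prop :=
  ∀ s ∈ T, ∀ t ∈ T, s ≠ t → ∀ z, s z = 0 ∨ t z = 0

theorem schreyerGens_cons_subset_of_coprime {w : List (σ →₀ ℕ)} {m : σ →₀ ℕ}
    (hw : PairwiseCoprime (schreyerGens ord S w)) (hm : m ∈ schreyerGens ord S w) :
    schreyerGens ord S (m :: w) ⊆ {t ∈ schreyerGens ord S w | Precedes ord t m} := by
  refine schreyerGens_cons_subset (fun t ht htm => ⟨t, ⟨ht, htm⟩, fun z => ?_⟩)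
    fun t ht => ⟨t, ht.1, ht.2, le_self_add⟩
  rw [Finsupp.tsub_apply]
  have hne : t ≠ m := by
    rintro rfl
    exact not_precedes_self ord _ htm
  rcases hw t ht m hm hne z with h | h <;> omega

theorem schreyerGens_append_of_coprime {w : List (σ →₀ ℕ)}
    (hw : PairwiseCoprime (schreyerGens ord S w)) : ∀ l : List (σ →₀ ℕ),
      IsSchreyerName ord S (l ++ w) → l.Nodup ∧ (∀ m ∈ l, m ∈ schreyerGens ord S w) ∧
        schreyerGens ord S (l ++ w) ⊆ schreyerGens ord S w ∧
        ∀ t ∈ schreyerGens ord S (l ++ w), ∀ m ∈ l, Precedes ord t m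
  | [], _ => ⟨List.nodup_nil, by simp, subset_rfl, by simp⟩
  | m :: l, h => by
    obtain ⟨h₁, h₂, h₃, h₄⟩ := schreyerGens_append_of_coprime hw l h.2
    have hm : m ∈ schreyerGens ord S (l ++ w) := h.1
    have hsub := schreyerGens_cons_subset_of_coprime
      (fun s hs t ht => hw s (h₃ hs) t (h₃ ht)) hm
    refine ⟨List.nodup_cons.2 ⟨fun hml => not_precedes_self ord _ (h₄ m hm m hml), h₁⟩,
      List.forall_mem_cons.2 ⟨h₃ hm, h₂⟩, fun t ht => h₃ (hsub ht).1, fun t ht =>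
      List.forall_mem_cons.2 ⟨(hsub ht).2, h₄ t (hsub ht).1⟩⟩

theorem IsSchreyerName.of_append {w : List (σ →₀ ℕ)} : ∀ l : List (σ →₀ ℕ),
    IsSchreyerName ord S (l ++ w) → IsSchreyerName ord S w
  | [], h => h
  | _ :: l, h => IsSchreyerName.of_append l h.2

end Koszul

section CarpetNames

variable {a b : ℕ}

/-- Powers of variables: `x_i` for `vx i`, except that `x_1` is replaced by its `c`-th power, and
`y_j` for `vy j`. -/
def koszulSet (a b : ℕ) (vx vy : ℕ → Prop) (c : ℕ) : Set (Vars a b →₀ ℕ) :=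
  {g | (∃ i : Fin (a + 1), vx i.1 ∧ g = Finsupp.single (Sum.inlₗ i) (if i.1 = 1 then c else 1)) ∨
    ∃ j : Fin (b + 1), vy j.1 ∧ g = Finsupp.single (Sum.inrₗ j) 1}

theorem koszulSet_eq_single {vx vy : ℕ → Prop} {c : ℕ} {x₁ : Fin (a + 1)} (hx₁ : x₁.1 = 1)
    {g : Vars a b →₀ ℕ} (hg : g ∈ koszulSet a b vx vy c) :
    ∃ z, g = Finsupp.single z (if z = Sum.inlₗ x₁ then c else 1) ∧
      (∀ i, z = Sum.inlₗ i → vx i.1) ∧ ∀ j, z = Sum.inrₗ j → vy j.1 := by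
  rcases hg with ⟨i, hi, rfl⟩ | ⟨j, hj, rfl⟩
  · refine ⟨Sum.inlₗ i, ?_, fun k hk => ?_, fun k hk => absurd hk Sum.inl_ne_inr⟩
    · congr 1
      refine if_congr ?_ rfl rfl
      exact ⟨fun h => congrArg Sum.inlₗ (Fin.ext (h.trans hx₁.symm)),
        fun h => (congrArg Fin.val (Sum.inl_injective h)).trans hx₁⟩
    · rwa [← Sum.inl_injective hk]
  · refine ⟨Sum.inrₗ j, ?_, fun k hk => absurd hk Sum.inr_ne_inl, fun k hk => ?_⟩
    · rw [if_neg]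
      exact Sum.inr_ne_inl
    · rwa [← Sum.inr_injective hk]

theorem pairwiseCoprime_of_subset_single {σ : Type} {e : σ → ℕ} {T : Set (σ →₀ ℕ)}
    (hT : ∀ g ∈ T, ∃ z, g = Finsupp.single z (e z)) : PairwiseCoprime T := by
  intro s hs t ht hst z
  obtain ⟨p, rfl⟩ := hT s hs
  obtain ⟨q, rfl⟩ := hT t ht
  rcases eq_or_ne z p with rfl | hp
  · rcases eq_or_ne z q with rfl | hq
    · exact absurd rfl hst
    · exact Or.inr (Finsupp.single_eq_of_ne hq)
  · exact Or.inl (Finsupp.single_eq_of_ne hp)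

theorem sum_of_nodup_single {σ : Type} {x₁ : σ} {e : σ → ℕ} (he : ∀ z, z ≠ x₁ → e z = 1)
    (he₁ : e x₁ = 1 ∨ e x₁ = 2) : ∀ l : List (σ →₀ ℕ), l.Nodup →
      (∀ g ∈ l, ∃ z, g = Finsupp.single z (e z)) →
      (∀ z, Finsupp.single z (e z) ∉ l → l.sum z = 0) ∧ (∀ z, l.sum z ≤ e z) ∧
        l.sum.degree = l.length + if 2 ≤ l.sum x₁ then 1 else 0
  | [], _, _ => by simp
  | g :: l, hn, hl => by
    obtain ⟨hg, hn'⟩ := List.nodup_cons.1 hn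
    obtain ⟨⟨p, rfl⟩, hl'⟩ := List.forall_mem_cons.1 hl
    obtain ⟨h₁, h₂, h₃⟩ := sum_of_nodup_single he he₁ l hn' hl'
    have hp := h₁ p hg
    refine ⟨fun z hz => ?_, fun z => ?_, ?_⟩
    · rw [List.mem_cons, not_or] at hz
      have hne : z ≠ p := by
        rintro rfl
        exact hz.1 rfl
      rw [List.sum_cons, Finsupp.add_apply, Finsupp.single_eq_of_ne hne, h₁ z hz.2]
    · rw [List.sum_cons, Finsupp.add_apply]
      rcases eq_or_ne z p with rfl | hne
      · rw [Finsupp.single_eq_same, hp, add_zero]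
      · rw [Finsupp.single_eq_of_ne hne, zero_add]
        exact h₂ z
    · rw [List.sum_cons, map_add, Finsupp.degree_single, h₃, Finsupp.add_apply, List.length_cons]
      rcases eq_or_ne x₁ p with rfl | hne
      · rw [Finsupp.single_eq_same, hp, if_neg (by omega : ¬ 2 ≤ 0)]
        split_ifs <;> omega
      · rw [Finsupp.single_eq_of_ne hne, zero_add, he p hne.symm]
        omega

/-- The sum of the part of a name that follows a name whose generators are powers of variables. -/
theorem sum_of_koszul {S : Set (Vars a b →₀ ℕ)} {vx vy : ℕ → Prop} {c : ℕ} (hc : c = 1 ∨ c = 2)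
    {x₁ : Fin (a + 1)} (hx₁ : x₁.1 = 1) {w l : List (Vars a b →₀ ℕ)}
    (hw : schreyerGens (revLex a b) S w ⊆ koszulSet a b vx vy c)
    (hl : IsSchreyerName (revLex a b) S (l ++ w)) :
    (∀ i : Fin (a + 1), ¬ vx i.1 → l.sum (Sum.inlₗ i) = 0) ∧
    (∀ j : Fin (b + 1), ¬ vy j.1 → l.sum (Sum.inrₗ j) = 0) ∧ l.sum (Sum.inlₗ x₁) ≤ c ∧
    l.sum.degree = l.length + if 2 ≤ l.sum (Sum.inlₗ x₁) then 1 else 0 := by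
  have hs := fun g hg => koszulSet_eq_single hx₁ (hw hg : g ∈ koszulSet a b vx vy c)
  obtain ⟨hn, hmem, -, -⟩ := schreyerGens_append_of_coprime
    (pairwiseCoprime_of_subset_single fun g hg => (hs g hg).imp fun z hz => hz.1) l hl
  set e : Vars a b → ℕ := fun z => if z = Sum.inlₗ x₁ then c else 1 with he
  have he₁ : e (Sum.inlₗ x₁) = c := if_pos rfl
  have hex : ∀ z, z ≠ Sum.inlₗ x₁ → e z = 1 := fun z hz => if_neg hz
  obtain ⟨h₁, h₂, h₃⟩ := sum_of_nodup_single hex (he₁ ▸ hc) l hn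
    fun g hg => (hs g (hmem g hg)).imp fun z hz => hz.1
  have hpos : ∀ z, 0 < e z := by
    intro z
    rcases eq_or_ne z (Sum.inlₗ x₁) with rfl | h
    · omega
    · rw [hex z h]
      exact one_pos
  have hinj : ∀ {z z'}, Finsupp.single z (e z) = Finsupp.single z' (e z') → z = z' := by
    intro z z' h
    exact Finsupp.single_left_injective (hpos z).ne' (by
      rcases Finsupp.single_eq_single_iff _ _ _ _ |>.1 h with h' | h'
      · rw [h'.1]
      · exact absurd h'.1 (hpos z).ne')
  refine ⟨fun i hi => h₁ _ fun hmem' => ?_, fun j hj => h₁ _ fun hmem' => ?_,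
    he₁ ▸ h₂ _, h₃⟩
  · obtain ⟨z, hz, hz₁, -⟩ := hs _ (hmem _ hmem')
    exact hi (hz₁ i (hinj hz).symm)
  · obtain ⟨z, hz, -, hz₂⟩ := hs _ (hmem _ hmem')
    exact hj (hz₂ j (hinj hz).symm)

end CarpetNames

section CarpetColons

theorem single_le_tsub {σ : Type} {z : σ} {n : ℕ} {t m : σ →₀ ℕ} (h : n + m z ≤ t z) :
    Finsupp.single z n ≤ t - m := by
  rw [Finsupp.single_le_iff, Finsupp.tsub_apply]
  omega

theorem pairExp_apply {σ : Type} [DecidableEq σ] (p q z : σ) :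
    pairExp p q z = (if p = z then 1 else 0) + if q = z then 1 else 0 := by
  rw [pairExp, Finsupp.add_apply, Finsupp.single_apply, Finsupp.single_apply]

theorem pairExp_le_left {σ : Type} (z r s : σ) :
    pairExp z s ≤ Finsupp.single z 1 + pairExp r s :=
  add_le_add_right le_add_self _

theorem pairExp_le_right {σ : Type} (z r s : σ) :
    pairExp r z ≤ Finsupp.single z 1 + pairExp r s := by
  rw [pairExp, add_comm]
  exact add_le_add_right le_self_add _

theorem pairExp_le_left' {σ : Type} (z r s : σ) :
    pairExp z r ≤ Finsupp.single z 1 + pairExp r s :=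
  add_le_add_right le_self_add _

theorem pairExp_self_le_add {σ : Type} (z : σ) (m : σ →₀ ℕ) :
    pairExp z z ≤ Finsupp.single z 2 + m := by
  rw [pairExp, ← Finsupp.single_add]
  exact le_self_add

variable {a b : ℕ}

theorem inl_eq_inl {i j : Fin (a + 1)} : (Sum.inlₗ i : Vars a b) = Sum.inlₗ j ↔ i.1 = j.1 :=
  ⟨fun h => congrArg Fin.val (Sum.inl_injective h), fun h => congrArg Sum.inlₗ (Fin.ext h)⟩

theorem inr_eq_inr {i j : Fin (b + 1)} : (Sum.inrₗ i : Vars a b) = Sum.inrₗ j ↔ i.1 = j.1 :=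
  ⟨fun h => congrArg Fin.val (Sum.inr_injective h), fun h => congrArg Sum.inrₗ (Fin.ext h)⟩

theorem inl_eq_inr {i : Fin (a + 1)} {j : Fin (b + 1)} :
    (Sum.inlₗ i : Vars a b) = Sum.inrₗ j ↔ False :=
  ⟨fun h => Sum.inl_ne_inr h, False.elim⟩

theorem inr_eq_inl {i : Fin (a + 1)} {j : Fin (b + 1)} :
    (Sum.inrₗ j : Vars a b) = Sum.inlₗ i ↔ False :=
  ⟨fun h => Sum.inr_ne_inl h, False.elim⟩

theorem inl_lt_inl {i j : Fin (a + 1)} : (Sum.inlₗ i : Vars a b) < Sum.inlₗ j ↔ i.1 < j.1 :=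
  Sum.Lex.inl_lt_inl_iff

theorem inr_lt_inr {i j : Fin (b + 1)} : (Sum.inrₗ i : Vars a b) < Sum.inrₗ j ↔ i.1 < j.1 :=
  Sum.Lex.inr_lt_inr_iff

theorem inl_lt_inr {i : Fin (a + 1)} {j : Fin (b + 1)} :
    (Sum.inlₗ i : Vars a b) < Sum.inrₗ j ↔ True :=
  ⟨fun _ => trivial, fun _ => Sum.Lex.inl_lt_inr i j⟩

theorem inr_lt_inl {i : Fin (a + 1)} {j : Fin (b + 1)} :
    (Sum.inrₗ j : Vars a b) < Sum.inlₗ i ↔ False :=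
  ⟨fun h => Sum.Lex.not_inr_lt_inl h, False.elim⟩

theorem LeadPair.xx {k l : Fin (a + 1)} (h₁ : 1 ≤ k.1) (h₂ : k.1 ≤ l.1) (h₃ : l.1 < a) :
    LeadPair a b (Sum.inlₗ k) (Sum.inlₗ l) :=
  Or.inl ⟨k, l, h₁, h₂, h₃, rfl, rfl⟩

theorem LeadPair.yy {k l : Fin (b + 1)} (h₁ : 1 ≤ k.1) (h₂ : k.1 ≤ l.1) (h₃ : l.1 < b) :
    LeadPair a b (Sum.inrₗ k) (Sum.inrₗ l) :=
  Or.inr (Or.inl ⟨k, l, h₁, h₂, h₃, rfl, rfl⟩)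

theorem LeadPair.xy {k : Fin (a + 1)} {l : Fin (b + 1)} (h₁ : 2 ≤ k.1) (h₂ : l.1 + 2 ≤ b) :
    LeadPair a b (Sum.inlₗ k) (Sum.inrₗ l) :=
  Or.inr (Or.inr ⟨k, l, h₁, h₂, rfl, rfl⟩)

theorem exists_precedes_le {p q r s : Vars a b} (hpq : LeadPair a b p q) (hrs : LeadPair a b r s)
    (h : q < s ∨ (q = s ∧ p < r)) {g : Vars a b →₀ ℕ} (hg : pairExp p q ≤ g + pairExp r s) :
    ∃ t ∈ schreyerGens (revLex a b) (leadExps a b) [], Precedes (revLex a b) t (pairExp r s) ∧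
      t ≤ g + pairExp r s :=
  ⟨_, mem_leadExps_iff.2 ⟨p, q, hpq, rfl⟩, (precedes_pairExp_iff hpq.le hrs.le).2 h, hg⟩

/-- The generators after a product of two variables `x_k`. -/
theorem schreyerGens_xx {k l : Fin (a + 1)} (h₁ : 1 ≤ k.1) (h₂ : k.1 ≤ l.1) (h₃ : l.1 < a) :
    schreyerGens (revLex a b) (leadExps a b) [pairExp (Sum.inlₗ k) (Sum.inlₗ l)] ⊆
      koszulSet a b (fun i => 1 ≤ i ∧ i < l.1) (fun _ => False) 1 := by
  have hrs : LeadPair a b (Sum.inlₗ k) (Sum.inlₗ l) := .xx h₁ h₂ h₃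
  refine schreyerGens_cons_subset (fun t ht htm => ?_) (fun g hg => ?_)
  · obtain ⟨p, q, hpq, rfl⟩ := mem_leadExps_iff.1 ht
    rw [precedes_pairExp_iff hpq.le hrs.le] at htm
    rcases hpq with ⟨i, j, hi, hij, hj, rfl, rfl⟩ | ⟨i, j, hi, hij, hj, rfl, rfl⟩ |
      ⟨i, j, hi, hj, rfl, rfl⟩ <;>
      simp only [inl_lt_inl, inr_lt_inl, inl_eq_inl, inr_eq_inl, false_and, or_self] at htm
    have hij' : i.1 ≤ j.1 := hij
    by_cases hjk : j.1 < l.1 ∧ j.1 ≠ k.1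
    · refine ⟨_, Or.inl ⟨j, ⟨by omega, hjk.1⟩, rfl⟩, single_le_tsub ?_⟩
      simp only [pairExp_apply, inl_eq_inl]
      split_ifs <;> omega
    · refine ⟨_, Or.inl ⟨i, ⟨hi, by omega⟩, rfl⟩, single_le_tsub ?_⟩
      simp only [pairExp_apply, inl_eq_inl]
      split_ifs <;> omega
  · rcases hg with ⟨i, hi, rfl⟩ | ⟨j, ⟨⟩, -⟩
    rw [ite_self]
    rcases lt_or_ge i.1 k.1 with h | h
    · exact exists_precedes_le (.xx hi.1 hi.2.le h₃) hrs (Or.inr ⟨rfl, inl_lt_inl.2 h⟩)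
        (pairExp_le_left _ _ _)
    · exact exists_precedes_le (.xx h₁ h (by omega)) hrs (Or.inl (inl_lt_inl.2 hi.2))
        (pairExp_le_right _ _ _)

/-- The generators after a product of variables `x_k` and `y_l`. -/
theorem schreyerGens_xy {k : Fin (a + 1)} {l : Fin (b + 1)} (h₁ : 2 ≤ k.1)
    (h₂ : l.1 + 2 ≤ b) :
    schreyerGens (revLex a b) (leadExps a b) [pairExp (Sum.inlₗ k) (Sum.inrₗ l)] ⊆
      koszulSet a b (fun i => 1 ≤ i ∧ i < a) (fun j => j < l.1) (if k.1 = a then 2 else 1) := by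
  have hrs : LeadPair a b (Sum.inlₗ k) (Sum.inrₗ l) := .xy h₁ h₂
  have hk : k.1 ≤ a := Nat.lt_succ_iff.1 k.2
  refine schreyerGens_cons_subset (fun t ht htm => ?_) (fun g hg => ?_)
  · obtain ⟨p, q, hpq, rfl⟩ := mem_leadExps_iff.1 ht
    rw [precedes_pairExp_iff hpq.le hrs.le] at htm
    rcases hpq with ⟨i, j, hi, hij, hj, rfl, rfl⟩ | ⟨i, j, hi, hij, hj, rfl, rfl⟩ |
      ⟨i, j, hi, hj, rfl, rfl⟩ <;>
      simp only [inl_lt_inl, inr_lt_inl, inr_lt_inr, inr_eq_inr, and_false, or_false] at htm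
    · have hij' : i.1 ≤ j.1 := hij
      by_cases hjk : j.1 = k.1
      · refine ⟨_, Or.inl ⟨i, ⟨hi, by omega⟩, rfl⟩, single_le_tsub ?_⟩
        simp only [pairExp_apply, inl_eq_inl, inr_eq_inl, if_false]
        split_ifs <;> omega
      · refine ⟨_, Or.inl ⟨j, ⟨by omega, hj⟩, rfl⟩, single_le_tsub ?_⟩
        simp only [pairExp_apply, inl_eq_inl, inr_eq_inl, if_false]
        split_ifs <;> omega
    · have hij' : i.1 ≤ j.1 := hij
      refine ⟨_, Or.inr ⟨j, htm, rfl⟩, single_le_tsub ?_⟩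
      simp only [pairExp_apply, inr_eq_inr, inl_eq_inr, if_false]
      split_ifs <;> omega
    · by_cases hjl : j.1 < l.1
      · refine ⟨_, Or.inr ⟨j, hjl, rfl⟩, single_le_tsub ?_⟩
        simp only [pairExp_apply, inr_eq_inr, inl_eq_inr]
        split_ifs <;> omega
      · refine ⟨_, Or.inl ⟨i, ⟨by omega, by omega⟩, rfl⟩, single_le_tsub ?_⟩
        simp only [pairExp_apply, inl_eq_inl, inr_eq_inl]
        split_ifs <;> omega
  · rcases hg with ⟨i, hi, rfl⟩ | ⟨j, hj, rfl⟩
    · rcases hk.lt_or_eq with hka | hka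
      · rw [if_neg hka.ne, ite_self]
        rcases le_total i.1 k.1 with h | h
        · exact exists_precedes_le (.xx hi.1 h hka) hrs (Or.inl (inl_lt_inr.2 trivial))
            (pairExp_le_left' _ _ _)
        · exact exists_precedes_le (.xx (by omega) h hi.2) hrs (Or.inl (inl_lt_inr.2 trivial))
            (pairExp_le_right _ _ _)
      · rw [if_pos hka]
        split_ifs with h
        · exact exists_precedes_le (.xx hi.1 le_rfl hi.2) hrs (Or.inl (inl_lt_inr.2 trivial))
            (pairExp_self_le_add _ _)
        · exact exists_precedes_le (.xy (by omega) h₂) hrs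
            (Or.inr ⟨rfl, inl_lt_inl.2 (by omega)⟩) (pairExp_le_left _ _ _)
    · exact exists_precedes_le (.xy h₁ (by omega)) hrs (Or.inl (inr_lt_inr.2 hj))
        (pairExp_le_right _ _ _)

/-- The generators after a product of two variables `y_k`, other than the square of `y_{b-1}`. -/
theorem schreyerGens_yy (ha : 2 ≤ a) {k l : Fin (b + 1)} (h₁ : 1 ≤ k.1) (h₂ : k.1 ≤ l.1)
    (h₃ : l.1 < b) (h₄ : k.1 + 2 ≤ b) :
    schreyerGens (revLex a b) (leadExps a b) [pairExp (Sum.inrₗ k) (Sum.inrₗ l)] ⊆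
      koszulSet a b (fun i => 1 ≤ i) (fun j => 1 ≤ j ∧ j < l.1) 2 := by
  have hrs : LeadPair a b (Sum.inrₗ k) (Sum.inrₗ l) := .yy h₁ h₂ h₃
  refine schreyerGens_cons_subset (fun t ht htm => ?_) (fun g hg => ?_)
  · obtain ⟨p, q, hpq, rfl⟩ := mem_leadExps_iff.1 ht
    rw [precedes_pairExp_iff hpq.le hrs.le] at htm
    rcases hpq with ⟨i, j, hi, hij, hj, rfl, rfl⟩ | ⟨i, j, hi, hij, hj, rfl, rfl⟩ |
      ⟨i, j, hi, hj, rfl, rfl⟩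
    · have hij' : i.1 ≤ j.1 := hij
      refine ⟨_, Or.inl ⟨j, by omega, rfl⟩, single_le_tsub ?_⟩
      simp only [pairExp_apply, inl_eq_inl, inr_eq_inl, if_false]
      split_ifs <;> omega
    · have hij' : i.1 ≤ j.1 := hij
      simp only [inr_lt_inr, inr_eq_inr] at htm
      by_cases hjk : j.1 < l.1 ∧ j.1 ≠ k.1
      · refine ⟨_, Or.inr ⟨j, ⟨by omega, hjk.1⟩, rfl⟩, single_le_tsub ?_⟩
        simp only [pairExp_apply, inr_eq_inr]
        split_ifs <;> omega
      · refine ⟨_, Or.inr ⟨i, ⟨hi, by omega⟩, rfl⟩, single_le_tsub ?_⟩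
        simp only [pairExp_apply, inr_eq_inr]
        split_ifs <;> omega
    · refine ⟨_, Or.inl ⟨i, by omega, rfl⟩, single_le_tsub ?_⟩
      simp only [pairExp_apply, inr_eq_inl, if_false]
      split_ifs <;> omega
  · rcases hg with ⟨i, hi, rfl⟩ | ⟨j, hj, rfl⟩
    · split_ifs with h
      · exact exists_precedes_le (.xx hi le_rfl (by omega)) hrs (Or.inl (inl_lt_inr.2 trivial))
          (pairExp_self_le_add _ _)
      · refine exists_precedes_le (.xy (by omega) h₄) hrs ?_ (pairExp_le_left' _ _ _)
        rcases h₂.lt_or_eq with h' | h'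
        · exact Or.inl (inr_lt_inr.2 h')
        · exact Or.inr ⟨inr_eq_inr.2 h', inl_lt_inr.2 trivial⟩
    · rcases lt_or_ge j.1 k.1 with h | h
      · exact exists_precedes_le (.yy hj.1 hj.2.le h₃) hrs (Or.inr ⟨rfl, inr_lt_inr.2 h⟩)
          (pairExp_le_left _ _ _)
      · exact exists_precedes_le (.yy h₁ h (by omega)) hrs (Or.inl (inr_lt_inr.2 hj.2))
          (pairExp_le_right _ _ _)

variable (a b) in
/-- The generators after the square of `y_{b-1}`. -/
def squareGens : Set (Vars a b →₀ ℕ) :=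
  {g | (∃ j : Fin (b + 1), 1 ≤ j.1 ∧ j.1 + 2 ≤ b ∧ g = Finsupp.single (Sum.inrₗ j) 1) ∨
    (∃ i j : Fin (a + 1), 1 ≤ i.1 ∧ i.1 ≤ j.1 ∧ j.1 < a ∧
      g = pairExp (Sum.inlₗ i) (Sum.inlₗ j)) ∨
    ∃ i : Fin (a + 1), 2 ≤ i.1 ∧ g = pairExp (Sum.inlₗ i) (Sum.inrₗ 0)}

theorem squareGens_antichain {g g' : Vars a b →₀ ℕ} (hg : g ∈ squareGens a b)
    (hg' : g' ∈ squareGens a b) (h : g ≤ g') : g = g' := by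
  have hpair : ∀ {p q : Vars a b}, g = pairExp p q → g = g' := by
    rintro p q rfl
    rcases hg' with ⟨j, -, -, rfl⟩ | ⟨i, j, -, -, -, rfl⟩ | ⟨i, -, rfl⟩
    · have := Finsupp.degree_mono h
      rw [degree_pairExp, Finsupp.degree_single] at this
      omega
    · exact pairExp_eq_of_le h
    · exact pairExp_eq_of_le h
  rcases hg with ⟨j, hj, -, rfl⟩ | ⟨i, j, -, -, -, hp⟩ | ⟨i, -, hp⟩
  · have hj' := Finsupp.single_le_iff.1 h
    rcases hg' with ⟨i, -, -, rfl⟩ | ⟨i, k, -, -, -, rfl⟩ | ⟨i, -, rfl⟩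
    · rw [Finsupp.single_apply] at hj'
      split_ifs at hj' with h
      · rw [h]
      · omega
    · simp only [pairExp_apply, inl_eq_inr, if_false] at hj'
      omega
    · simp only [pairExp_apply, inl_eq_inr, inr_eq_inr, if_false, Fin.val_zero] at hj'
      split_ifs at hj' <;> omega
  · exact hpair hp
  · exact hpair hp

theorem schreyerGens_square (hb : 2 ≤ b) {l : Fin (b + 1)} (hl : l.1 + 1 = b) :
    schreyerGens (revLex a b) (leadExps a b) [pairExp (Sum.inrₗ l) (Sum.inrₗ l)] =
      squareGens a b := by
  have hrs : LeadPair a b (Sum.inrₗ l) (Sum.inrₗ l) := .yy (by omega) le_rfl (by omega)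
  have hT : ∀ g ∈ squareGens a b, ∃ t ∈ schreyerGens (revLex a b) (leadExps a b) [],
      Precedes (revLex a b) t (pairExp (Sum.inrₗ l) (Sum.inrₗ l)) ∧
        t ≤ g + pairExp (Sum.inrₗ l) (Sum.inrₗ l) := by
    rintro g (⟨j, hj, hj', rfl⟩ | ⟨i, j, hi, hij, hj, rfl⟩ | ⟨i, hi, rfl⟩)
    · exact exists_precedes_le (.yy hj (by omega) (by omega : l.1 < b)) hrs
        (Or.inr ⟨rfl, inr_lt_inr.2 (by omega)⟩) (pairExp_le_left _ _ _)
    · exact exists_precedes_le (.xx hi hij hj) hrs (Or.inl (inl_lt_inr.2 trivial)) le_self_add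
    · refine exists_precedes_le (.xy hi (by simpa using hb)) hrs (Or.inl (inr_lt_inr.2 ?_))
        le_self_add
      rw [Fin.val_zero]
      omega
  have hsub : schreyerGens (revLex a b) (leadExps a b) [pairExp (Sum.inrₗ l) (Sum.inrₗ l)] ⊆
      squareGens a b := by
    refine schreyerGens_cons_subset (fun t ht htm => ?_) hT
    obtain ⟨p, q, hpq, rfl⟩ := mem_leadExps_iff.1 ht
    rw [precedes_pairExp_iff hpq.le hrs.le] at htm
    rcases hpq with ⟨i, j, hi, hij, hj, rfl, rfl⟩ | ⟨i, j, hi, hij, hj, rfl, rfl⟩ |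
      ⟨i, j, hi, hj, rfl, rfl⟩
    · refine ⟨_, Or.inr (Or.inl ⟨i, j, hi, hij, hj, rfl⟩), fun z => ?_⟩
      rw [Finsupp.tsub_apply]
      simp only [pairExp_apply]
      by_cases hz : (Sum.inrₗ l : Vars a b) = z
      · subst hz
        simp only [inl_eq_inr, if_false]
        omega
      · rw [if_neg hz]
        omega
    · have hij' : i.1 ≤ j.1 := hij
      simp only [inr_lt_inr, inr_eq_inr] at htm
      by_cases hjl : j.1 < l.1
      · refine ⟨_, Or.inl ⟨j, by omega, by omega, rfl⟩, single_le_tsub ?_⟩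
        simp only [pairExp_apply, inr_eq_inr]
        split_ifs <;> omega
      · refine ⟨_, Or.inl ⟨i, hi, by omega, rfl⟩, single_le_tsub ?_⟩
        simp only [pairExp_apply, inr_eq_inr]
        split_ifs <;> omega
    · by_cases hj0 : j.1 = 0
      · obtain rfl : j = 0 := Fin.ext hj0
        refine ⟨_, Or.inr (Or.inr ⟨i, hi, rfl⟩), fun z => ?_⟩
        rw [Finsupp.tsub_apply]
        simp only [pairExp_apply]
        by_cases hz : (Sum.inrₗ l : Vars a b) = z
        · subst hz
          simp only [inl_eq_inr, inr_eq_inr, if_false, Fin.val_zero]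
          split_ifs <;> omega
        · rw [if_neg hz]
          omega
      · refine ⟨_, Or.inl ⟨j, by omega, hj, rfl⟩, single_le_tsub ?_⟩
        simp only [pairExp_apply, inr_eq_inr, inl_eq_inr]
        split_ifs <;> omega
  exact hsub.antisymm (subset_schreyerGens_cons hsub hT fun g hg g' hg' =>
    squareGens_antichain hg hg')

theorem precedes_single_pairExp {σ : Type} {ord : MonomialOrder σ} (p q r : σ) :
    Precedes ord (Finsupp.single p 1) (pairExp q r) := by
  refine Or.inl ?_
  rw [degree_pairExp, Finsupp.degree_single]
  exact one_lt_two

theorem not_precedes_pairExp_single {σ : Type} {ord : MonomialOrder σ} (p q r : σ) :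
    ¬ Precedes ord (pairExp q r) (Finsupp.single p 1) := by
  rw [Precedes, degree_pairExp, Finsupp.degree_single]
  omega

section Square

variable {l : Fin (b + 1)}

theorem schreyerGens_square_y (hb : 2 ≤ b) (hl : l.1 + 1 = b) {j : Fin (b + 1)}
    (hj : j.1 + 2 ≤ b) :
    schreyerGens (revLex a b) (leadExps a b)
        [Finsupp.single (Sum.inrₗ j) 1, pairExp (Sum.inrₗ l) (Sum.inrₗ l)] ⊆
      koszulSet a b (fun _ => False) (fun i => 1 ≤ i ∧ i < j.1) 1 := by
  refine schreyerGens_cons_subset (fun t ht htm => ?_) (fun g hg => ?_)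
  · rw [schreyerGens_square hb hl] at ht
    rcases ht with ⟨i, hi, -, rfl⟩ | ⟨i, k, -, -, -, rfl⟩ | ⟨i, -, rfl⟩
    · have hij := inr_lt_inr.1 (precedes_single_iff.1 htm)
      refine ⟨_, Or.inr ⟨i, ⟨hi, hij⟩, rfl⟩, single_le_tsub ?_⟩
      rw [Finsupp.single_eq_same, Finsupp.single_eq_of_ne fun h => hij.ne (inr_eq_inr.1 h),
        add_zero]
    · exact absurd htm (not_precedes_pairExp_single _ _ _)
    · exact absurd htm (not_precedes_pairExp_single _ _ _)
  · rcases hg with ⟨i, ⟨⟩, -⟩ | ⟨i, hi, rfl⟩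
    rw [schreyerGens_square hb hl]
    exact ⟨_, Or.inl ⟨i, hi.1, by omega, rfl⟩, precedes_single_iff.2 (inr_lt_inr.2 hi.2),
      le_self_add⟩

theorem schreyerGens_square_xx (hb : 2 ≤ b) (hl : l.1 + 1 = b) {k m : Fin (a + 1)}
    (h₁ : 1 ≤ k.1) (h₂ : k.1 ≤ m.1) (h₃ : m.1 < a) :
    schreyerGens (revLex a b) (leadExps a b)
        [pairExp (Sum.inlₗ k) (Sum.inlₗ m), pairExp (Sum.inrₗ l) (Sum.inrₗ l)] ⊆
      koszulSet a b (fun i => 1 ≤ i ∧ i < m.1) (fun j => 1 ≤ j ∧ j + 2 ≤ b) 1 := by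
  have hrs : LeadPair a b (Sum.inlₗ k) (Sum.inlₗ m) := .xx h₁ h₂ h₃
  refine schreyerGens_cons_subset (fun t ht htm => ?_) (fun g hg => ?_)
  · rw [schreyerGens_square hb hl] at ht
    rcases ht with ⟨j, hj, hj', rfl⟩ | ⟨i, j, hi, hij, hj, rfl⟩ | ⟨i, -, rfl⟩
    · refine ⟨_, Or.inr ⟨j, ⟨hj, hj'⟩, rfl⟩, single_le_tsub ?_⟩
      simp only [pairExp_apply, inl_eq_inr, if_false, Finsupp.single_eq_same, le_refl, add_zero]
    · rw [precedes_pairExp_iff (LeadPair.xx hi hij hj : LeadPair a b _ _).le hrs.le] at htm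
      simp only [inl_lt_inl, inl_eq_inl] at htm
      by_cases hjk : j.1 < m.1 ∧ j.1 ≠ k.1
      · refine ⟨_, Or.inl ⟨j, ⟨by omega, hjk.1⟩, rfl⟩, single_le_tsub ?_⟩
        simp only [pairExp_apply, inl_eq_inl]
        split_ifs <;> omega
      · refine ⟨_, Or.inl ⟨i, ⟨hi, by omega⟩, rfl⟩, single_le_tsub ?_⟩
        simp only [pairExp_apply, inl_eq_inl]
        split_ifs <;> omega
    · rw [precedes_pairExp_iff (inl_le_inr _ _) hrs.le] at htm
      simp only [inr_lt_inl, inr_eq_inl, false_and, or_self] at htm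
  · rw [schreyerGens_square hb hl]
    rcases hg with ⟨i, hi, rfl⟩ | ⟨j, hj, rfl⟩
    · rw [ite_self]
      rcases lt_or_ge i.1 k.1 with h | h
      · have hp : LeadPair a b (Sum.inlₗ i) (Sum.inlₗ m) := .xx hi.1 hi.2.le h₃
        exact ⟨_, Or.inr (Or.inl ⟨i, m, hi.1, hi.2.le, h₃, rfl⟩),
          (precedes_pairExp_iff hp.le hrs.le).2 (Or.inr ⟨rfl, inl_lt_inl.2 h⟩),
          pairExp_le_left _ _ _⟩
      · have hp : LeadPair a b (Sum.inlₗ k) (Sum.inlₗ i) := .xx h₁ h (by omega)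
        exact ⟨_, Or.inr (Or.inl ⟨k, i, h₁, h, by omega, rfl⟩),
          (precedes_pairExp_iff hp.le hrs.le).2 (Or.inl (inl_lt_inl.2 hi.2)),
          pairExp_le_right _ _ _⟩
    · exact ⟨_, Or.inl ⟨j, hj.1, hj.2, rfl⟩, precedes_single_pairExp _ _ _, le_self_add⟩

theorem schreyerGens_square_xy (hb : 2 ≤ b) (hl : l.1 + 1 = b) {k : Fin (a + 1)}
    (h₁ : 2 ≤ k.1) :
    schreyerGens (revLex a b) (leadExps a b)
        [pairExp (Sum.inlₗ k) (Sum.inrₗ 0), pairExp (Sum.inrₗ l) (Sum.inrₗ l)] ⊆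
      koszulSet a b (fun i => 1 ≤ i ∧ i < a) (fun j => 1 ≤ j ∧ j + 2 ≤ b)
        (if k.1 = a then 2 else 1) := by
  have hk : k.1 ≤ a := Nat.lt_succ_iff.1 k.2
  refine schreyerGens_cons_subset (fun t ht htm => ?_) (fun g hg => ?_)
  · rw [schreyerGens_square hb hl] at ht
    rcases ht with ⟨j, hj, hj', rfl⟩ | ⟨i, j, hi, hij, hj, rfl⟩ | ⟨i, hi, rfl⟩
    · refine ⟨_, Or.inr ⟨j, ⟨hj, hj'⟩, rfl⟩, single_le_tsub ?_⟩
      simp only [pairExp_apply, inl_eq_inr, inr_eq_inr, if_false, Finsupp.single_eq_same,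
        Fin.val_zero]
      split_ifs <;> omega
    · by_cases hjk : j.1 = k.1
      · refine ⟨_, Or.inl ⟨i, ⟨hi, by omega⟩, rfl⟩, single_le_tsub ?_⟩
        simp only [pairExp_apply, inl_eq_inl, inr_eq_inl, if_false]
        split_ifs <;> omega
      · refine ⟨_, Or.inl ⟨j, ⟨by omega, hj⟩, rfl⟩, single_le_tsub ?_⟩
        simp only [pairExp_apply, inl_eq_inl, inr_eq_inl, if_false]
        split_ifs <;> omega
    · rw [precedes_pairExp_iff (inl_le_inr _ _) (inl_le_inr _ _)] at htm
      simp only [lt_self_iff_false, inl_lt_inl, true_and, false_or] at htm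
      refine ⟨_, Or.inl ⟨i, ⟨by omega, by omega⟩, rfl⟩, single_le_tsub ?_⟩
      simp only [pairExp_apply, inl_eq_inl, inr_eq_inl]
      split_ifs <;> omega
  · rw [schreyerGens_square hb hl]
    rcases hg with ⟨i, hi, rfl⟩ | ⟨j, hj, rfl⟩
    · have hxx : ∀ {i j : Fin (a + 1)}, i.1 ≤ j.1 → Precedes (revLex a b)
          (pairExp (Sum.inlₗ i) (Sum.inlₗ j)) (pairExp (Sum.inlₗ k) (Sum.inrₗ 0)) := fun h =>
        (precedes_pairExp_iff (Sum.Lex.inl_le_inl_iff.2 (Fin.le_def.2 h)) (inl_le_inr _ _)).2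
          (Or.inl (inl_lt_inr.2 trivial))
      rcases hk.lt_or_eq with hka | hka
      · rw [if_neg hka.ne, ite_self]
        rcases le_total i.1 k.1 with h | h
        · exact ⟨_, Or.inr (Or.inl ⟨i, k, hi.1, h, hka, rfl⟩), hxx h, pairExp_le_left' _ _ _⟩
        · exact ⟨_, Or.inr (Or.inl ⟨k, i, by omega, h, hi.2, rfl⟩), hxx h,
            pairExp_le_right _ _ _⟩
      · rw [if_pos hka]
        split_ifs with h
        · exact ⟨_, Or.inr (Or.inl ⟨i, i, hi.1, le_rfl, hi.2, rfl⟩), hxx le_rfl,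
            pairExp_self_le_add _ _⟩
        · exact ⟨_, Or.inr (Or.inr ⟨i, by omega, rfl⟩),
            (precedes_pairExp_iff (inl_le_inr _ _) (inl_le_inr _ _)).2
              (Or.inr ⟨rfl, inl_lt_inl.2 (by omega)⟩), pairExp_le_left _ _ _⟩
    · exact ⟨_, Or.inl ⟨j, hj.1, hj.2, rfl⟩, precedes_single_pairExp _ _ _, le_self_add⟩

end Square

end CarpetColons

section Strands

variable {a b : ℕ}

open Classical in
/-- The difference between the internal degree and the homological degree of a nonempty name, as a
function of the product of the name. -/
noncomputable def strand (x₁ : Fin (a + 1)) (l : Fin (b + 1)) (α : Vars a b →₀ ℕ) : ℕ :=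
  if 2 ≤ α (Sum.inrₗ l) then
    if ∀ i : Fin (a + 1), α (Sum.inlₗ i) = 0 then 1
    else if 1 ≤ α (Sum.inrₗ 0) ∧ 2 ≤ α (Sum.inlₗ x₁) then 3 else 2
  else if 2 ≤ α (Sum.inlₗ x₁) ∧ ∃ j : Fin (b + 1), α (Sum.inrₗ j) ≠ 0 then 2 else 1

variable {x₁ : Fin (a + 1)} {l : Fin (b + 1)} {n : List (Vars a b →₀ ℕ)}

theorem degree_sum_xx (hx₁ : x₁.1 = 1) {k m : Fin (a + 1)} (h₁ : 1 ≤ k.1) (h₂ : k.1 ≤ m.1)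
    (h₃ : m.1 < a)
    (hn : IsSchreyerName (revLex a b) (leadExps a b) (n ++ [pairExp (Sum.inlₗ k) (Sum.inlₗ m)])) :
    (n ++ [pairExp (Sum.inlₗ k) (Sum.inlₗ m)]).sum.degree =
      (n ++ [pairExp (Sum.inlₗ k) (Sum.inlₗ m)]).length +
        strand x₁ l (n ++ [pairExp (Sum.inlₗ k) (Sum.inlₗ m)]).sum := by
  obtain ⟨-, c₂, c₃, c₅⟩ := sum_of_koszul (Or.inl rfl) hx₁ (schreyerGens_xx h₁ h₂ h₃) hn
  have hy : ∀ j : Fin (b + 1),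
      (n ++ [pairExp (Sum.inlₗ k) (Sum.inlₗ m)]).sum (Sum.inrₗ j) = 0 := by
    intro j
    simp only [List.sum_append, List.sum_singleton, Finsupp.add_apply, pairExp_apply, inl_eq_inr,
      if_false]
    exact c₂ j id
  rw [strand, if_neg (by rw [hy]; omega), if_neg fun h => h.2.elim fun j hj => hj (hy j)]
  rw [if_neg (by omega)] at c₅
  simp only [List.sum_append, List.sum_singleton, map_add, degree_pairExp, c₅, List.length_append,
    List.length_singleton]

theorem degree_sum_xy (hx₁ : x₁.1 = 1) (hl : l.1 + 1 = b) {k : Fin (a + 1)} {m : Fin (b + 1)}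
    (h₁ : 2 ≤ k.1) (h₂ : m.1 + 2 ≤ b)
    (hn : IsSchreyerName (revLex a b) (leadExps a b) (n ++ [pairExp (Sum.inlₗ k) (Sum.inrₗ m)])) :
    (n ++ [pairExp (Sum.inlₗ k) (Sum.inrₗ m)]).sum.degree =
      (n ++ [pairExp (Sum.inlₗ k) (Sum.inrₗ m)]).length +
        strand x₁ l (n ++ [pairExp (Sum.inlₗ k) (Sum.inrₗ m)]).sum := by
  obtain ⟨-, c₂, -, c₅⟩ := sum_of_koszul (by split_ifs <;> simp) hx₁
    (schreyerGens_xy h₁ h₂) hn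
  have hl0 : (n ++ [pairExp (Sum.inlₗ k) (Sum.inrₗ m)]).sum (Sum.inrₗ l) = 0 := by
    simp only [List.sum_append, List.sum_singleton, Finsupp.add_apply, pairExp_apply, inl_eq_inr,
      inr_eq_inr, if_false]
    rw [c₂ l (by omega), if_neg (by omega)]
  have hm : (n ++ [pairExp (Sum.inlₗ k) (Sum.inrₗ m)]).sum (Sum.inrₗ m) ≠ 0 := by
    simp only [List.sum_append, List.sum_singleton, Finsupp.add_apply, pairExp_apply, if_true]
    omega
  have hx : (n ++ [pairExp (Sum.inlₗ k) (Sum.inrₗ m)]).sum (Sum.inlₗ x₁) =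
      n.sum (Sum.inlₗ x₁) := by
    simp only [List.sum_append, List.sum_singleton, Finsupp.add_apply, pairExp_apply, inl_eq_inl,
      inr_eq_inl, if_false]
    rw [if_neg (by omega)]
    rfl
  rw [strand, if_neg (by rw [hl0]; omega), hx]
  simp only [List.sum_append, List.sum_singleton, map_add, degree_pairExp, c₅, List.length_append,
    List.length_singleton]
  split_ifs with h₃ h₄ h₄
  · omega
  · exact absurd ⟨h₃, _, by simpa only [List.sum_append, List.sum_singleton] using hm⟩ h₄
  · exact absurd h₄.1 h₃
  · omega

theorem degree_sum_yy (ha : 2 ≤ a) (hx₁ : x₁.1 = 1) (hl : l.1 + 1 = b) {k m : Fin (b + 1)}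
    (h₁ : 1 ≤ k.1) (h₂ : k.1 ≤ m.1) (h₃ : m.1 < b) (h₄ : k.1 + 2 ≤ b)
    (hn : IsSchreyerName (revLex a b) (leadExps a b) (n ++ [pairExp (Sum.inrₗ k) (Sum.inrₗ m)])) :
    (n ++ [pairExp (Sum.inrₗ k) (Sum.inrₗ m)]).sum.degree =
      (n ++ [pairExp (Sum.inrₗ k) (Sum.inrₗ m)]).length +
        strand x₁ l (n ++ [pairExp (Sum.inrₗ k) (Sum.inrₗ m)]).sum := by
  obtain ⟨-, c₂, -, c₅⟩ := sum_of_koszul (Or.inr rfl) hx₁ (schreyerGens_yy ha h₁ h₂ h₃ h₄) hn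
  have hl0 : (n ++ [pairExp (Sum.inrₗ k) (Sum.inrₗ m)]).sum (Sum.inrₗ l) ≤ 1 := by
    simp only [List.sum_append, List.sum_singleton, Finsupp.add_apply, pairExp_apply, inr_eq_inr]
    rw [c₂ l (by omega), if_neg (by omega)]
    split_ifs <;> omega
  have hm : (n ++ [pairExp (Sum.inrₗ k) (Sum.inrₗ m)]).sum (Sum.inrₗ m) ≠ 0 := by
    simp only [List.sum_append, List.sum_singleton, Finsupp.add_apply, pairExp_apply, if_true]
    omega
  have hx : (n ++ [pairExp (Sum.inrₗ k) (Sum.inrₗ m)]).sum (Sum.inlₗ x₁) =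
      n.sum (Sum.inlₗ x₁) := by
    simp only [List.sum_append, List.sum_singleton, Finsupp.add_apply, pairExp_apply,
      inr_eq_inl, if_false]
    rfl
  rw [strand, if_neg (by omega), hx]
  simp only [List.sum_append, List.sum_singleton, map_add, degree_pairExp, c₅, List.length_append,
    List.length_singleton]
  split_ifs with h₃ h₄ h₄
  · omega
  · exact absurd ⟨h₃, _, by simpa only [List.sum_append, List.sum_singleton] using hm⟩ h₄
  · exact absurd h₄.1 h₃
  · omega

theorem degree_sum_square_y (hb : 2 ≤ b) (hx₁ : x₁.1 = 1) (hl : l.1 + 1 = b) {j : Fin (b + 1)}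
    (hj : j.1 + 2 ≤ b) {u : List (Vars a b →₀ ℕ)}
    (hu : u = n ++ [Finsupp.single (Sum.inrₗ j) 1, pairExp (Sum.inrₗ l) (Sum.inrₗ l)])
    (hn : IsSchreyerName (revLex a b) (leadExps a b) u) :
    u.sum.degree = u.length + strand x₁ l u.sum := by
  rw [hu] at hn
  obtain ⟨c₁, -, c₃, c₅⟩ := sum_of_koszul (Or.inl rfl) hx₁ (schreyerGens_square_y hb hl hj) hn
  have hsum : u.sum = n.sum + (Finsupp.single (Sum.inrₗ j) 1 +
      pairExp (Sum.inrₗ l) (Sum.inrₗ l)) := by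
    rw [hu, List.sum_append, List.sum_pair]
  rw [if_neg (by omega)] at c₅
  have h₁ : 2 ≤ u.sum (Sum.inrₗ l) := by
    simp only [hsum, Finsupp.add_apply, pairExp_apply, if_true]
    omega
  have h₂ : ∀ i : Fin (a + 1), u.sum (Sum.inlₗ i) = 0 := by
    intro i
    simp only [hsum, Finsupp.add_apply, pairExp_apply, Finsupp.single_apply, inr_eq_inl, if_false]
    exact c₁ i id
  rw [strand, if_pos h₁, if_pos h₂, hsum, map_add, map_add, c₅, Finsupp.degree_single,
    degree_pairExp, hu, List.length_append]
  simp only [List.length_cons, List.length_nil]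

theorem degree_sum_square_xx (hb : 2 ≤ b) (hx₁ : x₁.1 = 1) (hl : l.1 + 1 = b)
    {k m : Fin (a + 1)} (h₁ : 1 ≤ k.1) (h₂ : k.1 ≤ m.1) (h₃ : m.1 < a) {u : List (Vars a b →₀ ℕ)}
    (hu : u = n ++ [pairExp (Sum.inlₗ k) (Sum.inlₗ m), pairExp (Sum.inrₗ l) (Sum.inrₗ l)])
    (hn : IsSchreyerName (revLex a b) (leadExps a b) u) :
    u.sum.degree = u.length + strand x₁ l u.sum := by
  rw [hu] at hn
  obtain ⟨-, c₂, c₃, c₅⟩ := sum_of_koszul (Or.inl rfl) hx₁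
    (schreyerGens_square_xx hb hl h₁ h₂ h₃) hn
  have hsum : u.sum = n.sum + (pairExp (Sum.inlₗ k) (Sum.inlₗ m) +
      pairExp (Sum.inrₗ l) (Sum.inrₗ l)) := by
    rw [hu, List.sum_append, List.sum_pair]
  rw [if_neg (by omega)] at c₅
  have e₁ : 2 ≤ u.sum (Sum.inrₗ l) := by
    simp only [hsum, Finsupp.add_apply, pairExp_apply, if_true]
    omega
  have e₂ : ¬ ∀ i : Fin (a + 1), u.sum (Sum.inlₗ i) = 0 := by
    intro h
    have := h k
    simp only [hsum, Finsupp.add_apply, pairExp_apply, if_true] at this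
    omega
  have e₃ : u.sum (Sum.inrₗ 0) = 0 := by
    simp only [hsum, Finsupp.add_apply, pairExp_apply, inl_eq_inr, inr_eq_inr, if_false,
      Fin.val_zero]
    rw [c₂ 0 (by simp), if_neg (by omega), add_zero, add_zero, add_zero]
  rw [strand, if_pos e₁, if_neg e₂, if_neg (by omega), hsum, map_add, map_add, c₅,
    degree_pairExp, degree_pairExp, hu, List.length_append]
  simp only [List.length_cons, List.length_nil]

theorem degree_sum_square_xy (hb : 2 ≤ b) (hx₁ : x₁.1 = 1) (hl : l.1 + 1 = b)
    {k : Fin (a + 1)} (h₁ : 2 ≤ k.1) {u : List (Vars a b →₀ ℕ)}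
    (hu : u = n ++ [pairExp (Sum.inlₗ k) (Sum.inrₗ 0), pairExp (Sum.inrₗ l) (Sum.inrₗ l)])
    (hn : IsSchreyerName (revLex a b) (leadExps a b) u) :
    u.sum.degree = u.length + strand x₁ l u.sum := by
  rw [hu] at hn
  obtain ⟨-, -, -, c₅⟩ := sum_of_koszul (by split_ifs <;> simp) hx₁
    (schreyerGens_square_xy hb hl h₁) hn
  have hsum : u.sum = n.sum + (pairExp (Sum.inlₗ k) (Sum.inrₗ 0) +
      pairExp (Sum.inrₗ l) (Sum.inrₗ l)) := by
    rw [hu, List.sum_append, List.sum_pair]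
  have e₁ : 2 ≤ u.sum (Sum.inrₗ l) := by
    simp only [hsum, Finsupp.add_apply, pairExp_apply, if_true]
    omega
  have e₂ : ¬ ∀ i : Fin (a + 1), u.sum (Sum.inlₗ i) = 0 := by
    intro h
    have := h k
    simp only [hsum, Finsupp.add_apply, pairExp_apply, if_true] at this
    omega
  have e₃ : 1 ≤ u.sum (Sum.inrₗ 0) := by
    simp only [hsum, Finsupp.add_apply, pairExp_apply, if_true]
    omega
  have e₄ : u.sum (Sum.inlₗ x₁) = n.sum (Sum.inlₗ x₁) := by
    simp only [hsum, Finsupp.add_apply, pairExp_apply, inl_eq_inl, inr_eq_inl, if_false]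
    rw [if_neg (by omega)]
    rfl
  rw [strand, if_pos e₁, if_neg e₂, e₄, hsum, map_add, map_add, c₅,
    degree_pairExp, degree_pairExp, hu, List.length_append]
  simp only [List.length_cons, List.length_nil, ← hsum, e₃, true_and]
  split_ifs <;> omega

/-- The homological degree of a nonempty name is determined by the product of the name. -/
theorem degree_sum_eq (ha : 2 ≤ a) (hb : 2 ≤ b) (hx₁ : x₁.1 = 1) (hl : l.1 + 1 = b)
    {u : List (Vars a b →₀ ℕ)} (hu : u ≠ [])
    (hn : IsSchreyerName (revLex a b) (leadExps a b) u) :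
    u.sum.degree = u.length + strand x₁ l u.sum := by
  obtain ⟨n, m, rfl⟩ := (List.eq_nil_or_concat' u).resolve_left hu
  have hm : m ∈ leadExps a b := (IsSchreyerName.of_append n hn).1
  obtain ⟨p, q, ⟨i, j, hi, hij, hj, rfl, rfl⟩ | ⟨i, j, hi, hij, hj, rfl, rfl⟩ |
    ⟨i, j, hi, hj, rfl, rfl⟩, rfl⟩ := mem_leadExps_iff.1 hm
  · exact degree_sum_xx hx₁ hi hij hj hn
  · have hij' : i.1 ≤ j.1 := hij
    by_cases hil : i.1 + 2 ≤ b
    · exact degree_sum_yy ha hx₁ hl hi hij hj hil hn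
    obtain rfl : i = l := Fin.ext (by omega)
    obtain rfl : j = i := Fin.ext (by omega)
    rcases List.eq_nil_or_concat' n with rfl | ⟨n, m, rfl⟩
    · have h₁ : 2 ≤ pairExp (Sum.inrₗ j) (Sum.inrₗ j) (Sum.inrₗ j : Vars a b) := by
        simp only [pairExp_apply, if_true]
        omega
      have h₂ : ∀ i : Fin (a + 1),
          pairExp (Sum.inrₗ j) (Sum.inrₗ j) (Sum.inlₗ i : Vars a b) = 0 := by
        intro i
        simp only [pairExp_apply, inr_eq_inl, if_false]
      rw [List.nil_append, List.sum_singleton, strand, if_pos h₁, if_pos h₂, degree_pairExp]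
      rfl
    · rw [List.append_assoc, List.singleton_append] at hn ⊢
      have hm : m ∈ squareGens a b := by
        rw [← schreyerGens_square hb hl]
        exact (IsSchreyerName.of_append n hn).1
      rcases hm with ⟨k, -, hk, rfl⟩ | ⟨k, m, h₁, h₂, h₃, rfl⟩ | ⟨k, hk, rfl⟩
      · exact degree_sum_square_y hb hx₁ hl hk rfl hn
      · exact degree_sum_square_xx hb hx₁ hl h₁ h₂ h₃ rfl hn
      · exact degree_sum_square_xy hb hx₁ hl hk rfl hn
  · exact degree_sum_xy hx₁ hl hi hj hn

theorem sum_ne_sum (ha : 2 ≤ a) (hb : 2 ≤ b) (p : ℕ)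
    (u : SchreyerBasis (revLex a b) (leadExps a b) (p + 1))
    (v : SchreyerBasis (revLex a b) (leadExps a b) p) : u.1.sum ≠ v.1.sum := by
  intro h
  have key : ∀ w : List (Vars a b →₀ ℕ), w ≠ [] →
      IsSchreyerName (revLex a b) (leadExps a b) w →
      w.sum.degree = w.length + strand ⟨1, by omega⟩ ⟨b - 1, by omega⟩ w.sum := fun w hw hn =>
    degree_sum_eq ha hb rfl (Nat.sub_add_cancel (by omega)) hw hn
  have hu := key u.1 (List.ne_nil_of_length_eq_add_one u.2.1) u.2.2
  rcases eq_or_ne v.1 [] with hv | hv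
  · rw [h, hv, List.sum_nil, map_zero, u.2.1] at hu
    omega
  · have hv' := key v.1 hv v.2.2
    rw [h, u.2.1] at hu
    rw [v.2.1] at hv'
    omega

theorem finite_leadExps : (leadExps a b).Finite := by
  refine (Set.finite_range fun z : Vars a b × Vars a b => pairExp z.1 z.2).subset ?_
  intro m hm
  obtain ⟨p, q, -, rfl⟩ := mem_leadExps_iff.1 hm
  exact ⟨(p, q), rfl⟩

theorem initialIdeal_carpetIdeal (ha : 2 ≤ a) (hb : 2 ≤ b) :
    initialIdeal (revLex a b) (carpetIdeal a b) =
      Ideal.span ((fun m => monomial m (1 : ℤ)) '' leadExps a b) :=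
  (isNormalizedGroebnerBasis_carpetForms ha hb).initialIdeal_eq.trans
    (span_leadingTerm_eq _ fun _ => isUnit_leadingCoeff_carpetForms)

end Strands

end Carpet

theorem mainTheorem3 (a b : ℕ) (ha : 2 ≤ a) (hb : 2 ≤ b) :
    Carpet.carpetIdeal a b = Ideal.span (Carpet.carpetForms a b) ∧
    Carpet.IsNormalizedGroebnerBasis (Carpet.revLex a b) (Carpet.carpetIdeal a b)
      (Carpet.carpetForms a b) ∧
    (∃ d, Carpet.IsSchreyerResolution (R := ℤ) (Carpet.revLex a b) (Carpet.leadExps a b) d) ∧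
    ∀ d, Carpet.IsSchreyerResolution (R := ℤ) (Carpet.revLex a b) (Carpet.leadExps a b) d →
      Carpet.IsMinimalFreeResolution
        (ι := Carpet.SchreyerBasis (Carpet.revLex a b) (Carpet.leadExps a b))
        (fun _ u => u.deg) d
        (Carpet.augmentation _
          (Carpet.initialIdeal (Carpet.revLex a b) (Carpet.carpetIdeal a b))) :=
  ⟨Carpet.carpetIdeal_eq_span ha hb, Carpet.isNormalizedGroebnerBasis_carpetForms ha hb,
    Carpet.exists_isSchreyerResolution _ _ _, fun _ hd =>
      hd.isMinimalFreeResolution Carpet.finite_leadExps _ (Carpet.initialIdeal_carpetIdeal ha hb)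
        (Carpet.sum_ne_sum ha hb)⟩
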